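/- Let $\xi_1,\xi_2,\dots$ be independent random variables, uniformly distributed on $[0,1]$, and let $T_n$ ($n\ge 0$) be the random binary tree which the binary search tree algorithm generates from $\xi_1,\dots,\xi_n$: $T_0$ is empty, and $T_{n+1}$ is obtained from $T_n$ by moving from the root to the left or to the right according to whether $\xi_{n+1}$ is smaller or greater than the label of the current node, until an empty position is found, where a new node with label $\xi_{n+1}$ is attached. Regard a binary tree $T$ as the finite prefix-stable set of the $0$-$1$ words that encode its nodes ($0$ = left, $1$ = right, the root being the empty word). For $s\in[0,1]$ with binary expansion $s=\sum_{k\ge1}u_k2^{-k}$ (ending in zeros if $s<1$ is a binary rational) let $X_s(T):=\min\{k\ge 0:(u_1,\dots,u_k)\notin T\}$. Put $$\eta(T):=\int_0^1 X_s(T)\,ds,\qquad \eta_n:=\eta(T_n),\qquad H_n:=\sum_{k=1}^n\frac1k .$$ As $n\to\infty$, $\eta_n-H_n$ converges almost surely and in quadratic mean to a square integrable random variable $\eta_\infty$, and the following holds. (a) Let $\{\zeta_{n,k}: n\in\mathbb N_0,\ k\in\{1,\dots,2^n\}\}$ be a family of independent random variables, all with the same distribution as $$\zeta_\infty:=1+\tfrac12\bigl(\log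 U+\log(1-U)\bigr),\qquad U \text{ uniformly distributed on } [0,1].$$ Then the series $\sum_{n=0}^\infty 2^{-n}\sum_{k=1}^{2^n}\zeta_{n,k}$ converges almost surely and in quadratic mean, and its sum has the same distribution as $\eta_\infty$: $$\eta_\infty =_{\mathcal D} \sum_{n=0}^{\infty}2^{-n}\sum_{k=1}^{2^n}\zeta_{n,k}.$$ (b) The moment generating function $M(t)=E\exp(t\eta_\infty)$ is finite for all $t>-2$. (c) For all $n\in\mathbb N_0$ and all $t>-2$, $E\exp\bigl(t(\eta_n-H_n)\bigr)\le M(t)$, where the left-hand side is finite. -/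

import Mathlib

open MeasureTheory ProbabilityTheory Filter Topology

namespace BST

/-- Insertion of the label `x` into a labelled binary search tree: starting at the root, move to the
left if `x` is smaller than the label of the current node and to the right otherwise, and attach a
new node with label `x` at the first empty position. (Equal labels have probability zero.) -/
noncomputable def insert (x : ℝ) : BinaryTree ℝ → BinaryTree ℝ
  | .nil => .node x .nil .nil
  | .node a l r => if x < a then .node a (insert x l) r else .node a l (insert x r)

/-- The labelled tree that stores the first `n` values `x 0, …, x (n - 1)` of the sequence `x`. -/
noncomputable def labelledTree (x : ℕ → ℝ) : ℕ → BinaryTree ℝ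
  | 0 => .nil
  | n + 1 => insert (x n) (labelledTree x n)

/-- The finite, prefix-stable set of nodes of a labelled tree. Nodes are words over `Bool`, where
`false` (the letter 0) means a move to the left, `true` (the letter 1) a move to the right; the root
is the empty word. -/
def nodes : BinaryTree ℝ → Finset (List Bool)
  | .nil => ∅
  | .node _ l r => {[]} ∪ (nodes l).image (List.cons false) ∪ (nodes r).image (List.cons true)

/-- The `k`-th binary digit (`k ≥ 1`) of `s ∈ [0, 1]`. Binary rationals `s < 1` get the expansion
that ends in zeros; all digits of `1` are one. -/
noncomputable def binaryDigit (s : ℝ) (k : ℕ) : Bool :=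
  if s = 1 then true else decide (⌊2 ^ k * s⌋ % 2 = 1)

/-- The word `(u_1, …, u_k)` of the first `k` binary digits of `s`. -/
noncomputable def binaryPrefix (s : ℝ) (k : ℕ) : List Bool :=
  (List.range k).map fun i => binaryDigit s (i + 1)

/-- The silhouette `X_s(T)`: the least `k` such that the word `(u_1, …, u_k)` is not a node of `T`,
i.e. the depth of the external node of `T` along the path given by `s`. -/
noncomputable def silhouette (T : Finset (List Bool)) (s : ℝ) : ℕ :=
  sInf {k : ℕ | binaryPrefix s k ∉ T}

/-- The discounted external path length `η(T) = ∫₀¹ X_s(T) ds`. -/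
noncomputable def discountedPathLength (T : Finset (List Bool)) : ℝ :=
  ∫ s in (0 : ℝ)..1, (silhouette T s : ℝ)

/-- `η_n = η(T_n)`, where `T_n` is the tree generated from `x 0, …, x (n - 1)`. -/
noncomputable def eta (x : ℕ → ℝ) (n : ℕ) : ℝ :=
  discountedPathLength (nodes (labelledTree x n))

/-- The uniform distribution on the unit interval. -/
noncomputable def unif : Measure ℝ := volume.restrict (Set.Icc 0 1)

/-- The distribution of `ζ_∞ = 1 + (log U + log (1 - U)) / 2` with `U` uniform on `[0, 1]`. -/
noncomputable def zetaLaw : Measure ℝ :=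
  unif.map fun u => 1 + (1 / 2) * (Real.log u + Real.log (1 - u))

/-- The partial sum `∑_{n < N} 2^{-n} ∑_{k=1}^{2^n} z_{n,k}`. -/
noncomputable def zetaSum (z : (Σ n : ℕ, Fin (2 ^ n)) → ℝ) (N : ℕ) : ℝ :=
  ∑ n ∈ Finset.range N, ((2 : ℝ) ^ n)⁻¹ * ∑ k : Fin (2 ^ n), z ⟨n, k⟩

end BST

/-! Attaching a node at an external position `v` adds `2 ^ (-|v|)` to the path length, and these
weights sum to 1 over the `n + 1` external positions. The position taken by a new label is its rank
among the earlier labels. Given the past, this rank is uniform on `n + 1` values, so the path length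
grows by `1 / (n + 1)` on average and `η_n - H_n` is a martingale (`martingale_process`). Let `a n`
be the mean of the sum of `4 ^ (-|v|)`. The squared increment has mean at most `a n / (n + 1) = 2 *
(a n - a (n + 1))`; these bounds telescope, which yields a limit `Y` almost surely and in quadratic
mean (`IsExchangeable.exists_limit`).

Splitting a tree at its root gives two independent random search trees, with uniformly distributed
sizes (`treeMean_succ_eq_sum_antidiagonal`). In the limit the relative size becomes a uniform `U`,
differences of harmonic numbers become logarithms, and the characteristic function `φ` of `Y`
satisfies `φ(t) = φ_ζ(t) φ(t/2) ^ 2` (`charFun_limit`). Iterating this `N` times produces the first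
`N` levels of the series times `φ(t / 2 ^ N) ^ (2 ^ N)`, and the last factor tends to 1 because `Y`
is centred with finite variance (`IsZetaFamily.map_eq`).

For `t > -2` the mean of `exp (t ζ)` is a Beta integral. As `ζ` is centred, the generating function
of a summand with weight `c` is at most `exp (c ^ 2 * C)`. Level `n` has `2 ^ n` summands with `c =
2 ^ (-n)`, so the product over all levels stays bounded, and Fatou's lemma carries the bound to the
sum of the series and thereby to `Y`. Conditional Jensen then gives the comparison with finite `n`,
since the martingale is closed by `Y`. -/

namespace BST

/-! ### Functionals of unlabelled trees and their sums over one-node extensions -/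

/-- The unlabelled tree underlying a labelled one. -/
def shape : BinaryTree ℝ → BinaryTree Unit := BinaryTree.map fun _ => ()

/-- All trees that arise from a tree by attaching a node at an external position, in order. -/
def extensions : BinaryTree Unit → List (BinaryTree Unit)
  | .nil => [.node () .nil .nil]
  | .node _ l r =>
    (extensions l).map (fun l' => .node () l' r) ++ (extensions r).map (fun r' => .node () l r')

/-- The discounted external path length, `∑ 2 ^ (-|v|)` over the nodes `v`, in recursive form. -/
noncomputable def nodeWeight : BinaryTree Unit → ℝ
  | .nil => 0
  | .node _ l r => 1 + (nodeWeight l + nodeWeight r) / 2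

/-- The sum of `4 ^ (-|v|)` over the external positions `v` of a tree. -/
noncomputable def externalSq : BinaryTree Unit → ℝ
  | .nil => 1
  | .node _ l r => (externalSq l + externalSq r) / 4

/-- The sum of `f` over all one-node extensions of a tree. -/
def sumExt {E : Type*} [AddCommMonoid E] (f : BinaryTree Unit → E) (t : BinaryTree Unit) : E :=
  ((extensions t).map f).sum

section sumExt

variable {E : Type*} [AddCommMonoid E]

lemma sumExt_nil (f : BinaryTree Unit → E) : sumExt f .nil = f (.node () .nil .nil) := by
  simp [sumExt, extensions]

lemma sumExt_node (f : BinaryTree Unit → E) (u : Unit) (l r : BinaryTree Unit) :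
    sumExt f (.node u l r) =
      sumExt (fun l' => f (.node () l' r)) l + sumExt (fun r' => f (.node () l r')) r := by
  simp [sumExt, extensions, Function.comp_def]

end sumExt

lemma length_extensions (t : BinaryTree Unit) : (extensions t).length = t.numNodes + 1 := by
  induction t with
  | nil => rfl
  | node u l r hl hr => simp [extensions, BinaryTree.numNodes, hl, hr]; ring

lemma sumExt_const (c : ℝ) (t : BinaryTree Unit) : sumExt (fun _ => c) t = (t.numNodes + 1) * c := by
  simp [sumExt, length_extensions]

lemma sumExt_add (f g : BinaryTree Unit → ℝ) (t : BinaryTree Unit) :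
    sumExt (fun s => f s + g s) t = sumExt f t + sumExt g t := by
  simp [sumExt, List.sum_map_add]

lemma sumExt_mul_right (f : BinaryTree Unit → ℝ) (c : ℝ) (t : BinaryTree Unit) :
    sumExt (fun s => f s * c) t = sumExt f t * c := by
  simp [sumExt, List.sum_map_mul_right]

lemma numNodes_of_mem_extensions {t s : BinaryTree Unit} (h : s ∈ extensions t) :
    s.numNodes = t.numNodes + 1 := by
  induction t generalizing s with
  | nil => simp only [extensions, List.mem_singleton] at h; subst h; rfl
  | node u l r hl hr =>
    simp only [extensions, List.mem_append, List.mem_map] at h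
    rcases h with ⟨a, ha, rfl⟩ | ⟨a, ha, rfl⟩
    · simp [BinaryTree.numNodes, hl ha]; ring
    · simp [BinaryTree.numNodes, hr ha]; ring

lemma externalSq_nonneg (t : BinaryTree Unit) : 0 ≤ externalSq t := by
  induction t with
  | nil => simp [externalSq]
  | node u l r hl hr => simp only [externalSq]; positivity

/-- The extension at `v` gains `2 ^ (-|v|)`, and these gains total 1 by Kraft's equality. This is
the source of the centring by `H_n`. -/
lemma sumExt_nodeWeight (t : BinaryTree Unit) :
    sumExt nodeWeight t = (t.numNodes + 1) * nodeWeight t + 1 := by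
  induction t with
  | nil => simp [sumExt_nil, nodeWeight]
  | node u l r hl hr =>
    have e1 : (fun l' => nodeWeight (.node () l' r)) =
        fun l' => nodeWeight l' * (1 / 2) + (1 + nodeWeight r / 2) := by
      funext l'; simp only [nodeWeight]; ring
    have e2 : (fun r' => nodeWeight (.node () l r')) =
        fun r' => nodeWeight r' * (1 / 2) + (1 + nodeWeight l / 2) := by
      funext l'; simp only [nodeWeight]; ring
    rw [sumExt_node, e1, e2]
    simp only [sumExt_add, sumExt_mul_right, sumExt_const, hl, hr, nodeWeight, BinaryTree.numNodes]
    push_cast; ring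

/-- Filling `v` replaces `4 ^ (-|v|)` by two terms `4 ^ (-|v| - 1)`, so half of that term is lost.
-/
lemma sumExt_externalSq (t : BinaryTree Unit) :
    sumExt externalSq t = (t.numNodes + 1) * externalSq t - externalSq t / 2 := by
  induction t with
  | nil => norm_num [sumExt_nil, externalSq]
  | node u l r hl hr =>
    have e1 : (fun l' => externalSq (.node () l' r)) =
        fun l' => externalSq l' * (1 / 4) + externalSq r / 4 := by
      funext l'; simp only [externalSq]; ring
    have e2 : (fun r' => externalSq (.node () l r')) =
        fun r' => externalSq r' * (1 / 4) + externalSq l / 4 := by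
      funext l'; simp only [externalSq]; ring
    rw [sumExt_node, e1, e2]
    simp only [sumExt_add, sumExt_mul_right, sumExt_const, hl, hr, externalSq, BinaryTree.numNodes]
    push_cast; ring

/-- The increment at `v` is `2 ^ (-|v|)`, with square `4 ^ (-|v|)`. -/
lemma sumExt_sq_sub (t : BinaryTree Unit) :
    sumExt (fun s => (nodeWeight s - nodeWeight t) ^ 2) t = externalSq t := by
  induction t with
  | nil => norm_num [sumExt_nil, externalSq, nodeWeight]
  | node u l r hl hr =>
    have e1 : (fun l' => (nodeWeight (.node () l' r) - nodeWeight (.node u l r)) ^ 2) =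
        fun l' => (nodeWeight l' - nodeWeight l) ^ 2 * (1 / 4) := by
      funext l'; simp only [nodeWeight]; ring
    have e2 : (fun r' => (nodeWeight (.node () l r') - nodeWeight (.node u l r)) ^ 2) =
        fun r' => (nodeWeight r' - nodeWeight r) ^ 2 * (1 / 4) := by
      funext l'; simp only [nodeWeight]; ring
    rw [sumExt_node, e1, e2, sumExt_mul_right, sumExt_mul_right, hl, hr]
    simp only [externalSq]; ring

/-! ### Trees coded by rank lists -/

/-- The tree that grows by successively attaching nodes at the external positions with the given
indices; the list is read from its end. -/
def treeOf : List ℕ → BinaryTree Unit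
  | [] => .nil
  -- The default `.nil` never occurs for lists in `rankLists`: there the index is smaller than the
  -- number of external positions.
  | j :: h => ((extensions (treeOf h))[j]?).getD .nil

/-- The lists `[r_{n-1}, …, r_0]` with `r_i ≤ i`. -/
def rankLists : ℕ → Finset (List ℕ)
  | 0 => {[]}
  | n + 1 => (Finset.range (n + 1) ×ˢ rankLists n).image fun p => p.1 :: p.2

lemma cons_mem_rankLists {n j : ℕ} {h : List ℕ} :
    j :: h ∈ rankLists (n + 1) ↔ j < n + 1 ∧ h ∈ rankLists n := by
  simp [rankLists]

lemma numNodes_treeOf {n : ℕ} {h : List ℕ} (hh : h ∈ rankLists n) : (treeOf h).numNodes = n := by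
  induction n generalizing h with
  | zero => simp only [rankLists, Finset.mem_singleton] at hh; subst hh; rfl
  | succ n ih =>
    cases h with
    | nil => simp [rankLists] at hh
    | cons j h =>
      rw [cons_mem_rankLists] at hh
      have hj : j < (extensions (treeOf h)).length := by rw [length_extensions, ih hh.2]; exact hh.1
      rw [treeOf, List.getElem?_eq_getElem hj, Option.getD_some,
        numNodes_of_mem_extensions (List.getElem_mem hj), ih hh.2]

lemma sum_treeOf_cons {E : Type*} [AddCommMonoid E] (f : BinaryTree Unit → E) {n : ℕ} {h : List ℕ}
    (hh : h ∈ rankLists n) :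
    ∑ j ∈ Finset.range (n + 1), f (treeOf (j :: h)) = sumExt f (treeOf h) := by
  have hl : (extensions (treeOf h)).length = n + 1 := by rw [length_extensions, numNodes_treeOf hh]
  rw [sumExt, ← hl, ← Fin.sum_univ_fun_getElem, Finset.sum_range]
  refine Finset.sum_congr rfl fun i _ => ?_
  simp [treeOf]

/-! ### The shape of a search tree depends only on the ranks -/

/-- The labels of a tree. -/
def labels : BinaryTree ℝ → Multiset ℝ
  | .nil => 0
  | .node a l r => a ::ₘ (labels l + labels r)

/-- The search tree property. -/
def IsSearchTree : BinaryTree ℝ → Prop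
  | .nil => True
  | .node a l r => (∀ x ∈ labels l, x < a) ∧ (∀ x ∈ labels r, a ≤ x) ∧
      IsSearchTree l ∧ IsSearchTree r

lemma labels_insert (x : ℝ) (t : BinaryTree ℝ) : labels (insert x t) = x ::ₘ labels t := by
  induction t with
  | nil => simp [insert, labels]
  | node a l r hl hr =>
    by_cases h : x < a
    · simp [insert, h, labels, hl, Multiset.cons_swap]
    · simp [insert, h, labels, hr, Multiset.cons_swap]

lemma IsSearchTree.insert {x : ℝ} {t : BinaryTree ℝ} (ht : IsSearchTree t) :
    IsSearchTree (insert x t) := by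
  induction t with
  | nil => simp [BST.insert, IsSearchTree, labels]
  | node a l r hl hr =>
    obtain ⟨h1, h2, h3, h4⟩ := ht
    by_cases h : x < a
    · simp only [BST.insert, h, if_true]
      refine ⟨?_, h2, hl h3, h4⟩
      simpa [labels_insert] using ⟨h, h1⟩
    · simp only [BST.insert, h, if_false]
      refine ⟨h1, ?_, h3, hr h4⟩
      simpa [labels_insert] using ⟨not_lt.1 h, h2⟩

lemma card_labels (t : BinaryTree ℝ) : (labels t).card = (shape t).numNodes := by
  induction t with
  | nil => rfl
  | node a l r hl hr =>
    simp only [labels, Multiset.card_cons, Multiset.card_add, hl, hr]; rfl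

/-- Read from left to right, the external positions are the gaps between the sorted labels, and `x`
falls into the gap numbered by the count of smaller labels. -/
lemma extensions_getElem_countP {x : ℝ} {t : BinaryTree ℝ} (ht : IsSearchTree t)
    (hx : x ∉ labels t) :
    (extensions (shape t))[(labels t).countP (· < x)]? = some (shape (insert x t)) := by
  induction t with
  | nil => rfl
  | node a l r hl hr =>
    obtain ⟨h1, h2, h3, h4⟩ := ht
    simp only [labels, Multiset.mem_cons, Multiset.mem_add, not_or] at hx
    obtain ⟨hxa, hxl, hxr⟩ := hx
    have hs : shape (.node a l r) = .node () (shape l) (shape r) := rfl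
    rw [hs, extensions]
    rcases lt_or_gt_of_ne hxa with h | h
    · have hr0 : (labels r).countP (· < x) = 0 := by
        rw [Multiset.countP_eq_zero]
        intro y hy; have := h2 y hy; linarith
      have hle : (labels l).countP (· < x) < (extensions (shape l)).length := by
        rw [length_extensions, ← card_labels]
        exact Nat.lt_succ_of_le (Multiset.countP_le_card _ _)
      rw [labels, Multiset.countP_cons_of_neg _ (by linarith), Multiset.countP_add, hr0, add_zero,
        List.getElem?_append_left (by simpa using hle), List.getElem?_map, hl h3 hxl]
      simp only [insert, h, if_true]
      rfl
    · have hl0 : (labels l).countP (· < x) = (shape l).numNodes := by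
        rw [← card_labels, Multiset.countP_eq_card]
        intro y hy; have := h1 y hy; linarith
      rw [labels, Multiset.countP_cons_of_pos (p := (· < x)) _ h, Multiset.countP_add, hl0,
        List.getElem?_append_right (by simp [length_extensions]), List.length_map,
        length_extensions, List.getElem?_map]
      have : (shape l).numNodes + (labels r).countP (· < x) + 1 - ((shape l).numNodes + 1) =
        (labels r).countP (· < x) := by omega
      rw [this, hr h4 hxr]
      simp only [insert, not_lt.2 h.le, if_false]
      rfl

/-! ### Rank histories of the input sequence -/

/-- The rank of `x n` among the preceding entries. -/
noncomputable def rank (x : ℕ → ℝ) (n : ℕ) : ℕ := ((Finset.range n).filter fun i => x i < x n).card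

/-- The list of the ranks of the first `n` entries, the last one first. -/
noncomputable def rankHistory (x : ℕ → ℝ) : ℕ → List ℕ
  | 0 => []
  | n + 1 => rank x n :: rankHistory x n

lemma rank_lt (x : ℕ → ℝ) (n : ℕ) : rank x n < n + 1 :=
  Nat.lt_succ_of_le ((Finset.card_filter_le _ _).trans (by simp))

lemma rankHistory_mem (x : ℕ → ℝ) (n : ℕ) : rankHistory x n ∈ rankLists n := by
  induction n with
  | zero => simp [rankLists, rankHistory]
  | succ n ih => exact cons_mem_rankLists.2 ⟨rank_lt x n, ih⟩

lemma labels_labelledTree (x : ℕ → ℝ) (n : ℕ) :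
    labels (labelledTree x n) = (Multiset.range n).map x := by
  induction n with
  | zero => rfl
  | succ n ih => simp [labelledTree, labels_insert, ih]

lemma isSearchTree_labelledTree (x : ℕ → ℝ) (n : ℕ) : IsSearchTree (labelledTree x n) := by
  induction n with
  | zero => trivial
  | succ n ih => exact ih.insert

lemma shape_labelledTree {x : ℕ → ℝ} (hx : Function.Injective x) (n : ℕ) :
    shape (labelledTree x n) = treeOf (rankHistory x n) := by
  induction n with
  | zero => rfl
  | succ n ih =>
    have h := extensions_getElem_countP (x := x n) (isSearchTree_labelledTree x n) (by
      rw [labels_labelledTree]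
      simp only [Multiset.mem_map, Multiset.mem_range, not_exists, not_and]
      intro i hi h
      exact hi.ne (hx h))
    have hc : (labels (labelledTree x n)).countP (· < x n) = rank x n := by
      rw [labels_labelledTree, Multiset.countP_map, rank, Finset.card_def, Finset.filter_val]
      rfl
    rw [hc, ih] at h
    rw [rankHistory, treeOf, h]
    rfl

/-! ### The silhouette integral as a sum over nodes -/

/-- Doubling shifts the binary digits. The strict upper bound keeps `2 * s` away from 1, whose
digits follow a separate convention. -/
lemma binaryPrefix_succ_left {s : ℝ} (h0 : 0 ≤ s) (h : s < 1 / 2) (k : ℕ) :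
    binaryPrefix s (k + 1) = false :: binaryPrefix (2 * s) k := by
  unfold binaryPrefix
  rw [List.range_succ_eq_map, List.map_cons, List.map_map]
  congr 1
  · have : ⌊(2 : ℝ) ^ (0 + 1) * s⌋ = 0 := by
      rw [Int.floor_eq_zero_iff]; constructor <;> norm_num <;> linarith
    rw [binaryDigit, if_neg (by linarith), this]; rfl
  · refine List.map_congr_left fun i _ => ?_
    simp only [Function.comp, binaryDigit]
    rw [if_neg (by linarith), if_neg (by linarith), pow_succ (n := i + 1), mul_assoc]

lemma binaryPrefix_succ_right {s : ℝ} (h : 1 / 2 ≤ s) (h1 : s < 1) (k : ℕ) :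
    binaryPrefix s (k + 1) = true :: binaryPrefix (2 * s - 1) k := by
  unfold binaryPrefix
  rw [List.range_succ_eq_map, List.map_cons, List.map_map]
  congr 1
  · have : ⌊(2 : ℝ) ^ (0 + 1) * s⌋ = 1 := by
      rw [Int.floor_eq_iff]; constructor <;> norm_num <;> linarith
    rw [binaryDigit, if_neg (by linarith), this]; rfl
  · refine List.map_congr_left fun i _ => ?_
    simp only [Function.comp, binaryDigit]
    rw [if_neg (by linarith), if_neg (by linarith)]
    have e : (2 : ℝ) ^ (i + 1) * (2 * s - 1) = 2 ^ (i + 1 + 1) * s - ((2 ^ (i + 1) : ℤ) : ℝ) := by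
      push_cast; ring
    rw [e, Int.floor_sub_intCast]
    congr 1
    have h2 : (2 ^ (i + 1) : ℤ) % 2 = 0 := by rw [pow_succ]; exact Int.mul_emod_left _ _
    rw [Int.sub_emod, h2]
    simp

lemma exists_binaryPrefix_notMem (T : Finset (List Bool)) (s : ℝ) : ∃ k, binaryPrefix s k ∉ T := by
  by_contra! h
  have : Function.Injective (binaryPrefix s) := fun a b hab => by
    simpa [binaryPrefix] using congrArg List.length hab
  exact Set.infinite_range_of_injective this
    (T.finite_toSet.subset (by rintro _ ⟨k, rfl⟩; exact h k))

lemma silhouette_succ {T T' : Finset (List Bool)} {s s' : ℝ} (h0 : [] ∈ T)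
    (h : ∀ k, binaryPrefix s (k + 1) ∈ T ↔ binaryPrefix s' k ∈ T') :
    silhouette T s = silhouette T' s' + 1 := by
  unfold silhouette
  have e : {k : ℕ | binaryPrefix s' k ∉ T'} = {k | k + 1 ∈ {k : ℕ | binaryPrefix s k ∉ T}} := by
    ext k; simp [h]
  rw [e]
  refine (Nat.sInf_add ?_).symm
  have h2 := Nat.sInf_mem (s := {k : ℕ | binaryPrefix s k ∉ T}) (exists_binaryPrefix_notMem T s)
  rcases Nat.eq_zero_or_pos (sInf {k : ℕ | binaryPrefix s k ∉ T}) with h3 | h3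
  · rw [h3] at h2; exact absurd h0 h2
  · exact h3

lemma silhouette_node_left {s : ℝ} (h0 : 0 ≤ s) (h : s < 1 / 2) (a : ℝ) (l r : BinaryTree ℝ) :
    silhouette (nodes (.node a l r)) s = silhouette (nodes l) (2 * s) + 1 := by
  refine silhouette_succ (by simp [nodes]) fun k => ?_
  simp [binaryPrefix_succ_left h0 h, nodes]

lemma silhouette_node_right {s : ℝ} (h : 1 / 2 ≤ s) (h1 : s < 1) (a : ℝ) (l r : BinaryTree ℝ) :
    silhouette (nodes (.node a l r)) s = silhouette (nodes r) (2 * s - 1) + 1 := by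
  refine silhouette_succ (by simp [nodes]) fun k => ?_
  simp [binaryPrefix_succ_right h h1, nodes]

/-- The silhouette is self-similar: on each half of the unit interval it is 1 plus the rescaled
silhouette of a subtree. Integrability is carried through the induction because splitting the
integral requires it. -/
lemma discountedPathLength_nodes_aux (t : BinaryTree ℝ) :
    IntervalIntegrable (fun s => (silhouette (nodes t) s : ℝ)) volume 0 1 ∧
      discountedPathLength (nodes t) = nodeWeight (shape t) := by
  induction t with
  | nil =>
    have : ∀ s, silhouette (nodes .nil) s = 0 := fun s => by
      rw [silhouette, Nat.sInf_eq_zero]; left; simp [nodes]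
    simp only [discountedPathLength, this]
    simp [shape, BinaryTree.map, nodeWeight]
  | node a l r hl hr =>
    -- Open halves suffice: the endpoints are null for the integral, and the digit recursion may
    -- fail there.
    have e1 : Set.EqOn (fun s => (silhouette (nodes l) (2 * s) : ℝ) + 1)
        (fun s => (silhouette (nodes (.node a l r)) s : ℝ)) (Set.Ioo 0 (1 / 2)) := fun s hs => by
      simp [silhouette_node_left hs.1.le hs.2]
    have e2 : Set.EqOn (fun s => (silhouette (nodes r) (2 * s - 1) : ℝ) + 1)
        (fun s => (silhouette (nodes (.node a l r)) s : ℝ)) (Set.Ioo (1 / 2) 1) := fun s hs => by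
      simp [silhouette_node_right hs.1.le hs.2]
    have i1 : IntervalIntegrable (fun s => (silhouette (nodes l) (2 * s) : ℝ)) volume 0 (1 / 2) := by
      have := hl.1.comp_mul_left (c := 2)
      simpa using this
    have i2 : IntervalIntegrable (fun s => (silhouette (nodes r) (2 * s - 1) : ℝ)) volume
        (1 / 2) 1 := by
      have := (hr.1.comp_sub_right 1).comp_mul_left (c := 2)
      norm_num at this ⊢
      exact this
    have j1 : IntervalIntegrable (fun s => (silhouette (nodes (.node a l r)) s : ℝ)) volume 0
        (1 / 2) := (i1.add intervalIntegrable_const).congr_uIoo (by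
          rw [Set.uIoo_of_le (by norm_num)]; exact e1)
    have j2 : IntervalIntegrable (fun s => (silhouette (nodes (.node a l r)) s : ℝ)) volume
        (1 / 2) 1 := (i2.add intervalIntegrable_const).congr_uIoo (by
          rw [Set.uIoo_of_le (by norm_num)]; exact e2)
    refine ⟨j1.trans j2, ?_⟩
    rw [discountedPathLength, ← intervalIntegral.integral_add_adjacent_intervals j1 j2]
    have k1 : ∫ s in (0 : ℝ)..(1 / 2), (silhouette (nodes (.node a l r)) s : ℝ) =
        ∫ s in (0 : ℝ)..(1 / 2), ((silhouette (nodes l) (2 * s) : ℝ) + 1) :=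
      intervalIntegral.integral_congr_uIoo (by
        rw [Set.uIoo_of_le (by norm_num)]; exact e1.symm)
    have k2 : ∫ s in (1 / 2 : ℝ)..1, (silhouette (nodes (.node a l r)) s : ℝ) =
        ∫ s in (1 / 2 : ℝ)..1, ((silhouette (nodes r) (2 * s - 1) : ℝ) + 1) :=
      intervalIntegral.integral_congr_uIoo (by
        rw [Set.uIoo_of_le (by norm_num)]; exact e2.symm)
    rw [k1, k2, intervalIntegral.integral_add i1 intervalIntegrable_const,
      intervalIntegral.integral_add i2 intervalIntegrable_const,
      intervalIntegral.integral_comp_mul_left (fun s => (silhouette (nodes l) s : ℝ)) two_ne_zero,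
      intervalIntegral.integral_comp_mul_sub (fun s => (silhouette (nodes r) s : ℝ)) two_ne_zero]
    have hl2 := hl.2
    have hr2 := hr.2
    rw [discountedPathLength] at hl2 hr2
    have hs : shape (.node a l r) = .node () (shape l) (shape r) := rfl
    norm_num [hs, nodeWeight, ← hl2, ← hr2]
    ring

lemma discountedPathLength_nodes (t : BinaryTree ℝ) :
    discountedPathLength (nodes t) = nodeWeight (shape t) :=
  (discountedPathLength_nodes_aux t).2

lemma eta_eq {x : ℕ → ℝ} (hx : Function.Injective x) (n : ℕ) :
    eta x n = nodeWeight (treeOf (rankHistory x n)) := by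
  rw [eta, discountedPathLength_nodes, shape_labelledTree hx]

/-! ### Uniformity of ranks by swapping neighbours -/

/-- The positions `i < n` whose entry is a neighbour of `x n` in the order of `x 0, …, x n`. -/
def Adjacent (x : ℕ → ℝ) (n i : ℕ) : Prop := ∀ k < n, k ≠ i → (x k < x n ↔ x k < x i)

section swap

variable {x : ℕ → ℝ} {n i : ℕ}

lemma comp_swap_of_lt {k : ℕ} (hk : k < n) (hki : k ≠ i) : (x ∘ Equiv.swap i n) k = x k := by
  simp [Equiv.swap_apply_of_ne_of_ne hki hk.ne]

lemma Adjacent.comp_swap (h : Adjacent x n i) : Adjacent (x ∘ Equiv.swap i n) n i := by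
  intro k hk hki
  rw [comp_swap_of_lt hk hki]
  simpa using (h k hk hki).symm

lemma Adjacent.lt_iff (hx : Function.Injective x) (h : Adjacent x n i) {k : ℕ} (hk : k < n)
    (hki : k ≠ i) : x n < x k ↔ x i < x k := by
  have h1 := h k hk hki
  have h2 : x k ≠ x n := fun e => hk.ne (hx e)
  have h3 : x k ≠ x i := fun e => hki (hx e)
  constructor
  · intro h4
    exact lt_of_le_of_ne (not_lt.1 fun h5 => (h1.2 h5).not_gt h4) h3.symm
  · intro h4
    exact lt_of_le_of_ne (not_lt.1 fun h5 => (h1.1 h5).not_gt h4) h2.symm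

lemma Adjacent.comp_swap_lt_iff (hx : Function.Injective x) (h : Adjacent x n i) {a b : ℕ}
    (ha : a < n) (hb : b < n) :
    (x ∘ Equiv.swap i n) a < (x ∘ Equiv.swap i n) b ↔ x a < x b := by
  by_cases hai : a = i
  · by_cases hbi : b = i
    · subst hai; subst hbi; simp
    · rw [comp_swap_of_lt hb hbi]; subst hai
      simpa using h.lt_iff hx hb hbi
  · rw [comp_swap_of_lt ha hai]
    by_cases hbi : b = i
    · subst hbi
      simpa using h a ha hai
    · rw [comp_swap_of_lt hb hbi]

/-- No other entry lies between the two neighbours, so exchanging their values leaves the relative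
order of the first `n` entries unchanged; only the rank of the last entry moves, by one. -/
lemma Adjacent.rankHistory_comp_swap (hx : Function.Injective x) (h : Adjacent x n i) {m : ℕ}
    (hm : m ≤ n) : rankHistory (x ∘ Equiv.swap i n) m = rankHistory x m := by
  induction m with
  | zero => rfl
  | succ m ih =>
    rw [rankHistory, rankHistory, ih (by omega), rank, rank]
    congr 2
    refine Finset.filter_congr fun k hk => ?_
    have := Finset.mem_range.1 hk
    exact h.comp_swap_lt_iff hx (by omega) (by omega)

lemma Adjacent.rank_comp_swap (hi : i < n) (h : Adjacent x n i)
    (hlt : x n < x i) : rank (x ∘ Equiv.swap i n) n = rank x n + 1 := by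
  have e : (Finset.range n).filter (fun k => (x ∘ Equiv.swap i n) k < (x ∘ Equiv.swap i n) n) =
      Insert.insert i ((Finset.range n).filter fun k => x k < x n) := by
    ext k
    simp only [Finset.mem_filter, Finset.mem_range, Finset.mem_insert]
    by_cases hki : k = i
    · subst hki; simp [hi, hlt]
    · simp only [hki, false_or]
      refine and_congr_right fun hk => ?_
      rw [comp_swap_of_lt hk hki]
      simpa using (h k hk hki).symm
  rw [rank, rank, e, Finset.card_insert_of_notMem]
  simp [hlt.not_gt]

lemma exists_adjacent_gt (hx : Function.Injective x) (h : rank x n < n) :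
    ∃ i < n, x n < x i ∧ Adjacent x n i := by
  have hne : ((Finset.range n).filter fun k => x n < x k).Nonempty := by
    by_contra! h0
    refine h.ne ?_
    rw [rank, Finset.filter_true_of_mem, Finset.card_range]
    intro k hk
    rw [Finset.mem_range] at hk
    by_contra h1
    have : k ∈ (Finset.range n).filter fun k => x n < x k := by
      simp only [Finset.mem_filter, Finset.mem_range]
      exact ⟨hk, lt_of_le_of_ne (not_lt.1 h1) fun e => hk.ne' (hx e)⟩
    rw [h0] at this
    simp at this
  obtain ⟨i, hi, hmin⟩ := Finset.exists_min_image _ x hne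
  simp only [Finset.mem_filter, Finset.mem_range] at hi hmin
  refine ⟨i, hi.1, hi.2, fun k hk hki => ⟨fun h => h.trans hi.2, fun h => ?_⟩⟩
  by_contra h1
  have := hmin k ⟨hk, lt_of_le_of_ne (not_lt.1 h1) fun e => hk.ne' (hx e)⟩
  linarith

lemma exists_adjacent_lt (hx : Function.Injective x) (h : 0 < rank x n) :
    ∃ i < n, x i < x n ∧ Adjacent x n i := by
  obtain ⟨i, hi, hmax⟩ := Finset.exists_max_image _ x (Finset.card_pos.1 h)
  simp only [Finset.mem_filter, Finset.mem_range] at hi hmax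
  refine ⟨i, hi.1, hi.2, fun k hk hki => ⟨fun h => ?_, fun h => h.trans hi.2⟩⟩
  exact lt_of_le_of_ne (hmax k ⟨hk, h⟩) fun e => hki (hx e)

lemma adjacent_gt_unique {i' : ℕ} (hx : Function.Injective x) (hi : i < n) (hi' : i' < n)
    (h : x n < x i) (h' : x n < x i') (ha : Adjacent x n i) (ha' : Adjacent x n i') : i = i' := by
  by_contra hne
  have h1 := ha i' hi' (Ne.symm hne)
  have h2 := ha' i hi hne
  rcases lt_or_gt_of_ne (fun e => hne (hx e) : x i ≠ x i') with h3 | h3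
  · exact (h2.2 h3).not_gt h
  · exact (h1.2 h3).not_gt h'

lemma adjacent_lt_unique {i' : ℕ} (hi : i < n) (hi' : i' < n)
    (h : x i < x n) (h' : x i' < x n) (ha : Adjacent x n i) (ha' : Adjacent x n i') : i = i' := by
  by_contra hne
  have h1 := (ha i' hi' (Ne.symm hne)).1 h'
  have h2 := (ha' i hi hne).1 h
  exact h1.not_gt h2

end swap

section measurable

lemma measurableSet_coord_lt (i j : ℕ) : MeasurableSet {x : ℕ → ℝ | x i < x j} :=
  measurableSet_lt (measurable_pi_apply _) (measurable_pi_apply _)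

lemma measurable_rank (n : ℕ) : Measurable fun x : ℕ → ℝ => rank x n := by
  have e : (fun x : ℕ → ℝ => rank x n) =
      fun x => ∑ i ∈ Finset.range n, if x i < x n then 1 else 0 := by
    funext x; simp [rank]
  rw [e]
  exact Finset.measurable_sum _ fun i _ => Measurable.ite
    (measurableSet_coord_lt _ _) measurable_const
    measurable_const

lemma measurableSet_rankHistory (n : ℕ) (h : List ℕ) :
    MeasurableSet {x : ℕ → ℝ | rankHistory x n = h} := by
  induction n generalizing h with
  | zero => simp only [rankHistory]; exact MeasurableSet.const _
  | succ n ih =>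
    cases h with
    | nil => simp [rankHistory]
    | cons j h =>
      simp only [rankHistory, List.cons.injEq]
      exact (measurable_rank n (measurableSet_singleton j)).inter (ih h)

lemma measurableSet_adjacent (n i : ℕ) : MeasurableSet {x : ℕ → ℝ | Adjacent x n i} := by
  simp only [Adjacent, Set.ofPred_forall]
  refine MeasurableSet.iInter fun k => MeasurableSet.iInter fun _ => MeasurableSet.iInter fun _ => ?_
  exact (measurableSet_coord_lt _ _).iff
    (measurableSet_coord_lt _ _)

lemma measurableSet_injective : MeasurableSet {x : ℕ → ℝ | Function.Injective x} := by
  simp only [Function.Injective, Set.ofPred_forall]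
  refine MeasurableSet.iInter fun a => MeasurableSet.iInter fun b => ?_
  exact (measurableSet_eq_fun (measurable_pi_apply a) (measurable_pi_apply b)).imp
    (MeasurableSet.const _)

end measurable

/-- A law of sequences that is invariant under transpositions and charges only injective
sequences. -/
structure IsExchangeable (μ : Measure (ℕ → ℝ)) : Prop where
  map_swap : ∀ i j : ℕ, μ.map (fun x => x ∘ Equiv.swap i j) = μ
  ae_injective : ∀ᵐ x ∂μ, Function.Injective x

namespace IsExchangeable

variable {μ : Measure (ℕ → ℝ)}

lemma measurable_comp_swap (i j : ℕ) : Measurable fun x : ℕ → ℝ => x ∘ Equiv.swap i j :=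
  measurable_pi_iff.2 fun _ => measurable_pi_apply _

/-- Almost surely `x n` has exactly one upper neighbour when its rank is `j < n`, and one lower
neighbour when its rank is `j + 1`. Both events are partitioned by the position `i` of that
neighbour, and the transposition of `i` and `n` exchanges the corresponding pieces. -/
lemma measure_rankHistory_succ (hμ : IsExchangeable μ) (n j : ℕ) (h : List ℕ) (hj : j < n) :
    μ {x | rankHistory x (n + 1) = j :: h} = μ {x | rankHistory x (n + 1) = (j + 1) :: h} := by
  let A : ℕ → Set (ℕ → ℝ) := fun i => {x | rankHistory x (n + 1) = j :: h} ∩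
    ({x | x n < x i} ∩ {x | Adjacent x n i} ∩ {x | Function.Injective x})
  let B : ℕ → Set (ℕ → ℝ) := fun i => {x | rankHistory x (n + 1) = (j + 1) :: h} ∩
    ({x | x i < x n} ∩ {x | Adjacent x n i} ∩ {x | Function.Injective x})
  have hA : ∀ i, MeasurableSet (A i) := fun i => (measurableSet_rankHistory _ _).inter
    (((measurableSet_coord_lt _ _).inter
      (measurableSet_adjacent _ _)).inter measurableSet_injective)
  have hB : ∀ i, MeasurableSet (B i) := fun i => (measurableSet_rankHistory _ _).inter
    (((measurableSet_coord_lt _ _).inter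
      (measurableSet_adjacent _ _)).inter measurableSet_injective)
  have hAU : μ {x | rankHistory x (n + 1) = j :: h} = ∑ i ∈ Finset.range n, μ (A i) := by
    rw [← measure_biUnion_finset _ fun i _ => hA i]
    · refine measure_congr ?_
      filter_upwards [hμ.ae_injective] with x hx
      refine propext ⟨fun hx1 => ?_, fun hx1 => ?_⟩
      · have h1 : rankHistory x (n + 1) = j :: h := hx1
        have h2 : rank x n = j := by rw [rankHistory] at h1; exact (List.cons.inj h1).1
        obtain ⟨i, hi, h3, h4⟩ := exists_adjacent_gt hx (h2 ▸ hj)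
        exact Set.mem_biUnion (Finset.mem_coe.2 (Finset.mem_range.2 hi)) ⟨h1, ⟨h3, h4⟩, hx⟩
      · obtain ⟨i, -, hi⟩ := Set.mem_iUnion₂.1 hx1
        exact hi.1
    · intro i hi i' hi' hne
      refine Set.disjoint_left.2 fun x hx hx' => hne ?_
      exact adjacent_gt_unique hx.2.2 (by simpa using hi) (by simpa using hi') hx.2.1.1 hx'.2.1.1
        hx.2.1.2 hx'.2.1.2
  have hBU : μ {x | rankHistory x (n + 1) = (j + 1) :: h} = ∑ i ∈ Finset.range n, μ (B i) := by
    rw [← measure_biUnion_finset _ fun i _ => hB i]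
    · refine measure_congr ?_
      filter_upwards [hμ.ae_injective] with x hx
      refine propext ⟨fun hx1 => ?_, fun hx1 => ?_⟩
      · have h1 : rankHistory x (n + 1) = (j + 1) :: h := hx1
        have h2 : rank x n = j + 1 := by rw [rankHistory] at h1; exact (List.cons.inj h1).1
        have h5 : 0 < rank x n := by omega
        obtain ⟨i, hi, h3, h4⟩ := exists_adjacent_lt hx h5
        exact Set.mem_biUnion (Finset.mem_coe.2 (Finset.mem_range.2 hi)) ⟨h1, ⟨h3, h4⟩, hx⟩
      · obtain ⟨i, -, hi⟩ := Set.mem_iUnion₂.1 hx1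
        exact hi.1
    · intro i hi i' hi' hne
      refine Set.disjoint_left.2 fun x hx hx' => hne ?_
      exact adjacent_lt_unique (by simpa using hi) (by simpa using hi') hx.2.1.1 hx'.2.1.1
        hx.2.1.2 hx'.2.1.2
  rw [hAU, hBU]
  refine Finset.sum_congr rfl fun i hi => ?_
  rw [Finset.mem_range] at hi
  -- The first rewrite replaces the measure on both sides; the last one restores it on the side of
  -- `A i`.
  rw [← hμ.map_swap i n, Measure.map_apply (measurable_comp_swap i n) (hB i), hμ.map_swap i n]
  congr 1
  ext x
  have hinj : Function.Injective (x ∘ Equiv.swap i n) ↔ Function.Injective x :=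
    (Equiv.swap i n).injective_comp x
  constructor
  · rintro ⟨h1, ⟨h2, h3⟩, h4⟩
    simp only [Set.mem_ofPred_eq] at h1 h2 h3 h4
    rw [rankHistory, List.cons.injEq] at h1
    refine ⟨?_, ⟨?_, h3.comp_swap⟩, hinj.2 h4⟩
    · show rankHistory _ _ = _
      rw [rankHistory, h3.rankHistory_comp_swap h4 le_rfl, h3.rank_comp_swap hi h2, h1.1, h1.2]
    · simpa using h2
  · rintro ⟨h1, ⟨h2, h3⟩, h4⟩
    simp only [Set.mem_ofPred_eq] at h1 h2 h3 h4
    have e : (x ∘ Equiv.swap i n) ∘ Equiv.swap i n = x := by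
      funext k; simp
    have h2' : (x ∘ Equiv.swap i n) i < (x ∘ Equiv.swap i n) n := h2
    have h5 : x n < x i := by simpa using h2'
    have h6 : Adjacent x n i := by simpa only [e] using h3.comp_swap
    rw [rankHistory, List.cons.injEq, h6.rankHistory_comp_swap (hinj.1 h4) le_rfl,
      h6.rank_comp_swap hi h5] at h1
    refine ⟨?_, ⟨h5, h6⟩, hinj.1 h4⟩
    show rankHistory _ _ = _
    rw [rankHistory, h1.2]
    congr 1
    omega

lemma measure_rankHistory (hμ : IsExchangeable μ) (n j : ℕ) (h : List ℕ) (hj : j < n + 1) :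
    μ {x | rankHistory x n = h} = (n + 1 : ℕ) * μ {x | rankHistory x (n + 1) = j :: h} := by
  have h0 : ∀ i < n + 1, μ {x | rankHistory x (n + 1) = i :: h} =
      μ {x | rankHistory x (n + 1) = 0 :: h} := by
    intro i hi
    induction i with
    | zero => rfl
    | succ i ih => rw [← ih (by omega), hμ.measure_rankHistory_succ n i h (by omega)]
  have e : {x | rankHistory x n = h} =
      ⋃ i ∈ Finset.range (n + 1), {x | rankHistory x (n + 1) = i :: h} := by
    ext x
    simp only [rankHistory, List.cons.injEq, Set.mem_ofPred_eq, Set.mem_iUnion, Finset.mem_range,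
      exists_prop]
    exact ⟨fun h => ⟨rank x n, rank_lt x n, rfl, h⟩, fun ⟨_, _, _, h⟩ => h⟩
  rw [e, measure_biUnion_finset _ fun i _ => measurableSet_rankHistory _ _,
    Finset.sum_congr rfl fun i hi => h0 i (Finset.mem_range.1 hi), h0 j hj]
  · simp
  · intro i _ i' _ hne
    refine Set.disjoint_left.2 fun x hx hx' => hne ?_
    simp only [Set.mem_ofPred_eq] at hx hx'
    rw [hx] at hx'
    exact (List.cons.inj hx').1

end IsExchangeable

/-! ### Expectations of functions of the rank history -/

section expectation

variable {E : Type*} [NormedAddCommGroup E]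

lemma comp_rankHistory_eq_sum (n : ℕ) (G : List ℕ → E) :
    (fun x : ℕ → ℝ => G (rankHistory x n)) = fun x => ∑ h ∈ rankLists n,
      ({x | rankHistory x n = h} : Set (ℕ → ℝ)).indicator (fun _ => G h) x := by
  funext x
  rw [Finset.sum_eq_single (rankHistory x n)]
  · simp
  · intro h _ hne
    exact Set.indicator_of_notMem (fun e => hne e.symm) _
  · intro h; exact absurd (rankHistory_mem x n) h

variable {μ : Measure (ℕ → ℝ)} [IsFiniteMeasure μ]

lemma integrable_comp_rankHistory (n : ℕ) (G : List ℕ → E) :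
    Integrable (fun x : ℕ → ℝ => G (rankHistory x n)) μ := by
  rw [comp_rankHistory_eq_sum]
  exact integrable_finsetSum _ fun h _ =>
    (integrable_const _).indicator (measurableSet_rankHistory _ _)

variable [NormedSpace ℝ E]

lemma integral_comp_rankHistory [CompleteSpace E] (n : ℕ) (G : List ℕ → E) :
    ∫ x, G (rankHistory x n) ∂μ = ∑ h ∈ rankLists n, μ.real {x | rankHistory x n = h} • G h := by
  rw [comp_rankHistory_eq_sum, integral_finsetSum _ fun h _ =>
    (integrable_const _).indicator (measurableSet_rankHistory _ _)]
  refine Finset.sum_congr rfl fun h _ => ?_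
  rw [integral_indicator_const _ (measurableSet_rankHistory _ _)]

/-- The rank of a new entry is uniformly distributed and independent of the earlier ranks. -/
lemma IsExchangeable.integral_rankHistory_succ [CompleteSpace E] (hμ : IsExchangeable μ) (n : ℕ)
    (G : List ℕ → E) :
    ∫ x, G (rankHistory x (n + 1)) ∂μ =
      ((n : ℝ) + 1)⁻¹ • ∫ x, ∑ j ∈ Finset.range (n + 1), G (j :: rankHistory x n) ∂μ := by
  rw [integral_comp_rankHistory,
    integral_comp_rankHistory n fun h => ∑ j ∈ Finset.range (n + 1), G (j :: h), rankLists,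
    Finset.sum_image (by rintro ⟨a, b⟩ _ ⟨c, d⟩ _ h; simpa using h), Finset.sum_product_right,
    Finset.smul_sum]
  refine Finset.sum_congr rfl fun h _ => ?_
  rw [Finset.smul_sum, Finset.smul_sum]
  refine Finset.sum_congr rfl fun j hj => ?_
  rw [smul_smul]
  congr 1
  rw [measureReal_def, measureReal_def, hμ.measure_rankHistory n j h (Finset.mem_range.1 hj),
    ENNReal.toReal_mul, ENNReal.toReal_natCast]
  push_cast
  field_simp

end expectation

/-! ### Independent uniform sequences are exchangeable -/

section law

instance : IsProbabilityMeasure unif := by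
  constructor; simp [unif]

instance : NullSingletonClass unif := by unfold unif; infer_instance

lemma isExchangeable_map {Ω : Type*} [MeasurableSpace Ω] {P : Measure Ω} [IsProbabilityMeasure P]
    {ξ : ℕ → Ω → ℝ} (hm : ∀ i, Measurable (ξ i)) (hi : iIndepFun ξ P)
    (hl : ∀ i, P.map (ξ i) = unif) : IsExchangeable (P.map fun ω i => ξ i ω) := by
  have hmm : Measurable fun ω i => ξ i ω := measurable_pi_iff.2 hm
  constructor
  · intro i j
    rw [Measure.map_map (IsExchangeable.measurable_comp_swap i j) hmm,
      (iIndepFun_iff_map_fun_eq_infinitePi_map hm).1 hi]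
    have h2 := (iIndepFun_iff_map_fun_eq_infinitePi_map (fun k => hm (Equiv.swap i j k))).1
      (hi.precomp (Equiv.swap i j).injective)
    simp only [hl] at h2 ⊢
    exact h2
  · rw [ae_map_iff hmm.aemeasurable measurableSet_injective]
    have h : ∀ p : ℕ × ℕ, ∀ᵐ ω ∂P, ξ p.1 ω = ξ p.2 ω → p.1 = p.2 := by
      rintro ⟨i, j⟩
      by_cases hij : i = j
      · exact ae_of_all _ fun _ _ => hij
      have h1 := (indepFun_iff_map_prod_eq_prod_map_map (hm i).aemeasurable
        (hm j).aemeasurable).1 (hi.indepFun hij)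
      rw [hl, hl] at h1
      have hd : MeasurableSet {p : ℝ × ℝ | p.1 = p.2} := measurableSet_eq_fun measurable_fst
        measurable_snd
      have h2 : (unif.prod unif) {p : ℝ × ℝ | p.1 = p.2} = 0 := by
        rw [Measure.measure_prod_null hd]
        refine ae_of_all _ fun a => ?_
        have : Prod.mk a ⁻¹' {p : ℝ × ℝ | p.1 = p.2} = {a} := by
          ext b; simp [eq_comm]
        simp [this]
      rw [← h1, Measure.map_apply ((hm i).prodMk (hm j)) hd] at h2
      rw [ae_iff]
      refine measure_mono_null (fun ω hω => ?_) h2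
      simp only [Set.mem_ofPred_eq, Classical.not_imp] at hω
      exact hω.1
    filter_upwards [ae_all_iff.2 h] with ω hω i j hij using hω (i, j) hij

end law

/-! ### The martingale and its limit -/

lemma eLpNorm_two_eq_ofReal_sqrt {Ω : Type*} [MeasurableSpace Ω] {μ : Measure Ω} {f : Ω → ℝ}
    (hf : MemLp f 2 μ) : eLpNorm f 2 μ = ENNReal.ofReal (√(∫ x, f x ^ 2 ∂μ)) := by
  rw [hf.eLpNorm_eq_integral_rpow_norm two_ne_zero ENNReal.ofNat_ne_top, Real.sqrt_eq_rpow]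
  norm_num

lemma rankHistory_drop (x : ℕ → ℝ) (n k : ℕ) :
    (rankHistory x (n + k)).drop k = rankHistory x n := by
  induction k with
  | zero => rfl
  | succ k ih => rw [← add_assoc, rankHistory, List.drop_succ_cons, ih]

lemma measurable_rankHistory (n : ℕ) :
    Measurable[_, ⊤] fun x : ℕ → ℝ => rankHistory x n := by
  let : MeasurableSpace (List ℕ) := ⊤
  exact measurable_to_countable' fun h => measurableSet_rankHistory n h

/-- The filtration generated by the ranks. -/
noncomputable def rankFiltration : Filtration ℕ (inferInstance : MeasurableSpace (ℕ → ℝ)) where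
  seq n := MeasurableSpace.comap (fun x => rankHistory x n) ⊤
  mono' := by
    intro n m hnm
    obtain ⟨k, rfl⟩ := Nat.exists_eq_add_of_le hnm
    rintro _ ⟨s, -, rfl⟩
    refine ⟨{h | h.drop k ∈ s}, trivial, ?_⟩
    ext x
    simp [rankHistory_drop]
  le' n := (measurable_rankHistory n).comap_le

/-- `η_n - H_n` as a function of the list of ranks. -/
noncomputable def centered (n : ℕ) (h : List ℕ) : ℝ := nodeWeight (treeOf h) - (harmonic n : ℝ)

/-- `η_n - H_n` as a random variable on the space of input sequences. -/
noncomputable def process (n : ℕ) (x : ℕ → ℝ) : ℝ := centered n (rankHistory x n)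

lemma memLp_process (μ : Measure (ℕ → ℝ)) [IsProbabilityMeasure μ] (n : ℕ) :
    MemLp (process n) 2 μ := by
  refine (memLp_two_iff_integrable_sq ?_).2 (integrable_comp_rankHistory n fun h => centered n h ^ 2)
  exact (integrable_comp_rankHistory n (centered n)).1

lemma integrable_process (μ : Measure (ℕ → ℝ)) [IsProbabilityMeasure μ] (n : ℕ) :
    Integrable (process n) μ := integrable_comp_rankHistory n (centered n)

namespace IsExchangeable

variable {μ : Measure (ℕ → ℝ)} [IsProbabilityMeasure μ]

/-- This is the martingale property tested against functions of the past. Indicators give the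
conditional expectation; differences of the process give orthogonality of increments. -/
lemma integral_mul_process_succ (hμ : IsExchangeable μ) (n : ℕ) (g : List ℕ → ℝ) :
    ∫ x, g (rankHistory x n) * process (n + 1) x ∂μ =
      ∫ x, g (rankHistory x n) * process n x ∂μ := by
  have h := hμ.integral_rankHistory_succ n fun h => g h.tail * centered (n + 1) h
  simp only [rankHistory, List.tail_cons] at h
  simp only [process, rankHistory]
  rw [h, ← integral_smul]
  refine integral_congr_ae (ae_of_all _ fun x => ?_)
  have hn : ((n : ℝ) + 1) ≠ 0 := by positivity
  simp only [centered]
  rw [← Finset.mul_sum, Finset.sum_sub_distrib,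
    sum_treeOf_cons nodeWeight (rankHistory_mem x n), sumExt_nodeWeight,
    numNodes_treeOf (rankHistory_mem x n), harmonic_succ]
  simp only [Finset.sum_const, Finset.card_range, nsmul_eq_mul, smul_eq_mul]
  push_cast
  field_simp
  ring

/-- The process `η_n - H_n` is a martingale. -/
lemma martingale_process (hμ : IsExchangeable μ) : Martingale process rankFiltration μ := by
  refine martingale_of_setIntegral_eq_succ (fun n => ?_) (integrable_process μ) ?_
  · have h1 : Measurable[rankFiltration n, ⊤] fun x : ℕ → ℝ => rankHistory x n :=
      comap_measurable _
    have h2 : Measurable[⊤, _] (centered n) := measurable_from_top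
    exact (h2.comp h1).stronglyMeasurable
  · rintro n _ ⟨s, -, rfl⟩
    have hs : MeasurableSet ((fun x => rankHistory x n) ⁻¹' s) := measurable_rankHistory n trivial
    rw [← integral_indicator hs, ← integral_indicator hs]
    have e : ∀ m, (((fun x => rankHistory x n) ⁻¹' s).indicator fun x => process m x) =
        fun x => s.indicator 1 (rankHistory x n) * process m x := by
      intro m; funext x
      by_cases h : rankHistory x n ∈ s <;> simp [Set.indicator, h]
    rw [e, e]
    exact (hμ.integral_mul_process_succ n _).symm

lemma integral_externalSq_succ (hμ : IsExchangeable μ) (n : ℕ) :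
    ∫ x, externalSq (treeOf (rankHistory x (n + 1))) ∂μ =
      (1 - ((n : ℝ) + 1)⁻¹ / 2) * ∫ x, externalSq (treeOf (rankHistory x n)) ∂μ := by
  rw [hμ.integral_rankHistory_succ n fun h => externalSq (treeOf h), ← integral_smul,
    ← integral_const_mul]
  refine integral_congr_ae (ae_of_all _ fun x => ?_)
  have hn : ((n : ℝ) + 1) ≠ 0 := by positivity
  simp only [sum_treeOf_cons externalSq (rankHistory_mem x n), sumExt_externalSq,
    numNodes_treeOf (rankHistory_mem x n), smul_eq_mul]
  field_simp

/-- The right side equals `(n + 1)⁻¹` times the mean of `externalSq` at time `n`. Written as a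
difference it telescopes, so no decay rate is needed. -/
lemma integral_sq_process_sub_succ (hμ : IsExchangeable μ) (n : ℕ) :
    ∫ x, (process (n + 1) x - process n x) ^ 2 ∂μ ≤
      2 * (∫ x, externalSq (treeOf (rankHistory x n)) ∂μ) -
        2 * ∫ x, externalSq (treeOf (rankHistory x (n + 1))) ∂μ := by
  have hn : (0 : ℝ) < (n : ℝ) + 1 := by positivity
  have h := hμ.integral_rankHistory_succ n fun h => (centered (n + 1) h - centered n h.tail) ^ 2
  simp only [rankHistory, List.tail_cons] at h
  have e : (fun x => (process (n + 1) x - process n x) ^ 2) = fun x =>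
      (centered (n + 1) (rank x n :: rankHistory x n) - centered n (rankHistory x n)) ^ 2 := rfl
  rw [e, h, integral_externalSq_succ hμ n]
  have h2 : ∫ x, ∑ j ∈ Finset.range (n + 1),
      (centered (n + 1) (j :: rankHistory x n) - centered n (rankHistory x n)) ^ 2 ∂μ ≤
      ∫ x, externalSq (treeOf (rankHistory x n)) ∂μ := by
    refine integral_mono (integrable_comp_rankHistory n fun h => ∑ j ∈ Finset.range (n + 1),
      (centered (n + 1) (j :: h) - centered n h) ^ 2) (integrable_comp_rankHistory n
        fun h => externalSq (treeOf h)) fun x => ?_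
    -- Summed over `j`, the three terms give `externalSq`, `-2 / (n + 1)` and `1 / (n + 1)`; the
    -- last two add up to a negative number that is dropped.
    have e1 : ∀ j, (centered (n + 1) (j :: rankHistory x n) - centered n (rankHistory x n)) ^ 2 =
        (nodeWeight (treeOf (j :: rankHistory x n)) - nodeWeight (treeOf (rankHistory x n))) ^ 2 -
        2 * ((n : ℝ) + 1)⁻¹ * (nodeWeight (treeOf (j :: rankHistory x n)) -
          nodeWeight (treeOf (rankHistory x n))) + ((n : ℝ) + 1)⁻¹ ^ 2 := by
      intro j
      simp only [centered, harmonic_succ]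
      push_cast
      ring
    simp only [e1]
    rw [Finset.sum_add_distrib, Finset.sum_sub_distrib, ← Finset.mul_sum, Finset.sum_sub_distrib,
      sum_treeOf_cons (fun t => (nodeWeight t - nodeWeight (treeOf (rankHistory x n))) ^ 2)
        (rankHistory_mem x n), sumExt_sq_sub,
      sum_treeOf_cons nodeWeight (rankHistory_mem x n), sumExt_nodeWeight,
      numNodes_treeOf (rankHistory_mem x n)]
    simp only [Finset.sum_const, Finset.card_range, nsmul_eq_mul]
    have : (((n + 1 : ℕ) : ℝ)) * ((n : ℝ) + 1)⁻¹ ^ 2 = ((n : ℝ) + 1)⁻¹ := by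
      push_cast; field_simp
    rw [this]
    have h3 : 0 < ((n : ℝ) + 1)⁻¹ := by positivity
    push_cast
    linarith
  have h3 := mul_le_mul_of_nonneg_left h2 (inv_pos.2 hn).le
  rw [smul_eq_mul]
  linarith

lemma integral_sq_process_sub (hμ : IsExchangeable μ) (n k : ℕ) :
    ∫ x, (process (n + k) x - process n x) ^ 2 ∂μ ≤
      2 * (∫ x, externalSq (treeOf (rankHistory x n)) ∂μ) -
        2 * ∫ x, externalSq (treeOf (rankHistory x (n + k))) ∂μ := by
  induction k with
  | zero => simp
  | succ k ih =>
    have hL : ∀ m, MemLp (process m) 2 μ := memLp_process μ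
    have e : (fun x => (process (n + (k + 1)) x - process n x) ^ 2) = fun x =>
        (process (n + k) x - process n x) ^ 2 +
        (2 * ((process (n + k) x - process n x) * (process (n + k + 1) x - process (n + k) x)) +
        (process (n + k + 1) x - process (n + k) x) ^ 2) := by
      funext x; rw [← add_assoc]; ring
    have i1 : Integrable (fun x => (process (n + k) x - process n x) ^ 2) μ :=
      ((hL (n + k)).sub (hL n)).integrable_sq
    have i3 : Integrable (fun x => (process (n + k + 1) x - process (n + k) x) ^ 2) μ :=
      ((hL (n + k + 1)).sub (hL (n + k))).integrable_sq
    have i2 : Integrable (fun x => 2 * ((process (n + k) x - process n x) *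
        (process (n + k + 1) x - process (n + k) x))) μ := (((hL (n + k)).sub (hL n)).integrable_mul
      ((hL (n + k + 1)).sub (hL (n + k)))).const_mul 2
    -- The increment up to time `n + k` is a function of the rank history at that time, hence
    -- orthogonal to the next increment.
    have o : ∫ x, (process (n + k) x - process n x) *
        (process (n + k + 1) x - process (n + k) x) ∂μ = 0 := by
      have h := hμ.integral_mul_process_succ (n + k)
        fun h => centered (n + k) h - centered n (h.drop k)
      have e2 : ∀ x, centered (n + k) (rankHistory x (n + k)) -
          centered n ((rankHistory x (n + k)).drop k) = process (n + k) x - process n x := by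
        intro x; rw [rankHistory_drop]; rfl
      simp only [e2] at h
      simp only [mul_sub]
      rw [integral_sub, h, sub_self]
      · exact ((hL (n + k)).sub (hL n)).integrable_mul (hL (n + k + 1))
      · exact ((hL (n + k)).sub (hL n)).integrable_mul (hL (n + k))
    have i23 : Integrable (fun x => 2 * ((process (n + k) x - process n x) *
        (process (n + k + 1) x - process (n + k) x)) +
        (process (n + k + 1) x - process (n + k) x) ^ 2) μ := i2.add i3
    rw [e, integral_add i1 i23, integral_add i2 i3, integral_const_mul, o]
    have := hμ.integral_sq_process_sub_succ (n + k)
    rw [show n + (k + 1) = n + k + 1 from rfl]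
    linarith

/-- The almost sure and quadratic mean limit of `η_n - H_n`. -/
lemma exists_limit (hμ : IsExchangeable μ) : ∃ Y : (ℕ → ℝ) → ℝ, MemLp Y 2 μ ∧
    (∀ᵐ x ∂μ, Tendsto (fun n => process n x) atTop (𝓝 (Y x))) ∧
    Tendsto (fun n => eLpNorm (process n - Y) 2 μ) atTop (𝓝 0) := by
  set a : ℕ → ℝ := fun n => ∫ x, externalSq (treeOf (rankHistory x n)) ∂μ with ha
  have ha0 : ∀ n, 0 ≤ a n := fun n => integral_nonneg fun x => externalSq_nonneg _
  have hanti : Antitone a := by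
    refine antitone_nat_of_succ_le fun n => ?_
    have h1 := hμ.integral_externalSq_succ n
    have h2 : (0 : ℝ) < ((n : ℝ) + 1)⁻¹ := by positivity
    have h3 := mul_nonneg h2.le (ha0 n)
    simp only [ha] at h3 ⊢
    linarith
  have hbdd : BddBelow (Set.range a) := ⟨0, by rintro _ ⟨n, rfl⟩; exact ha0 n⟩
  have hlim : Tendsto a atTop (𝓝 (⨅ n, a n)) := tendsto_atTop_ciInf hanti hbdd
  have hL : ∀ m, MemLp (process m) 2 μ := memLp_process μ
  have hdiff : ∀ n k, eLpNorm (process (n + k) - process n) 2 μ ≤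
      ENNReal.ofReal √(2 * (a n - ⨅ n, a n)) := by
    intro n k
    rw [eLpNorm_two_eq_ofReal_sqrt ((hL _).sub (hL _))]
    refine ENNReal.ofReal_le_ofReal (Real.sqrt_le_sqrt ?_)
    have h1 := hμ.integral_sq_process_sub n k
    have h2 := ciInf_le hbdd (n + k)
    simp only [Pi.sub_apply]
    simp only [ha] at h2 ⊢
    linarith
  have hbound : ∀ n, eLpNorm (process n) 1 μ ≤ (Real.toNNReal √(2 * (a 0 - ⨅ n, a n)) : NNReal) := by
    intro n
    have h0 : process 0 = 0 := by
      funext x; simp [process, centered, rankHistory, treeOf, nodeWeight]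
    have h := hdiff 0 n
    rw [zero_add, h0, sub_zero] at h
    exact (eLpNorm_le_eLpNorm_of_exponent_le (by norm_num) (hL n).1).trans h
  have hae := hμ.martingale_process.submartingale.ae_tendsto_limitProcess hbound
  set Y := rankFiltration.limitProcess process μ with hY
  -- Fatou's lemma in `k` turns the uniform bound on increments after time `n` into a bound on the
  -- distance to the limit.
  have hsub : ∀ n, eLpNorm (Y - process n) 2 μ ≤ ENNReal.ofReal √(2 * (a n - ⨅ n, a n)) := by
    intro n
    refine (Lp.eLpNorm_lim_le_liminf_eLpNorm (f := fun k => process (n + k) - process n)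
      (fun k => ((hL _).sub (hL _)).1) _ ?_).trans ?_
    · filter_upwards [hae] with x hx
      have := (hx.comp (tendsto_add_atTop_nat n)).sub_const (process n x)
      simpa [Function.comp_def, add_comm] using this
    · exact (Filter.liminf_le_liminf (Eventually.of_forall (hdiff n))).trans (by simp)
  have hYm : AEStronglyMeasurable Y μ := by
    refine aestronglyMeasurable_of_tendsto_ae atTop (fun n => (hL n).1) hae
  refine ⟨Y, ?_, hae, ?_⟩
  · have h0 : MemLp (Y - process 0) 2 μ :=
      ⟨hYm.sub (hL 0).1, (hsub 0).trans_lt ENNReal.ofReal_lt_top⟩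
    simpa using h0.add (hL 0)
  · have h1 : Tendsto (fun n => ENNReal.ofReal √(2 * (a n - ⨅ n, a n))) atTop (𝓝 0) := by
      have h2 := (((hlim.sub_const (⨅ n, a n)).const_mul 2).sqrt)
      have h3 := ENNReal.tendsto_ofReal h2
      simpa using h3
    refine tendsto_of_tendsto_of_tendsto_of_le_of_le tendsto_const_nhds h1 (fun _ => zero_le) ?_
    intro n
    exact (eLpNorm_sub_comm _ _ _ _).trans_le (hsub n)

lemma integral_process (hμ : IsExchangeable μ) (n : ℕ) : ∫ x, process n x ∂μ = 0 := by
  induction n with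
  | zero => simp [process, centered, rankHistory, treeOf, nodeWeight]
  | succ n ih => simpa [ih] using hμ.integral_mul_process_succ n fun _ => 1

lemma process_eq_condExp (hμ : IsExchangeable μ) {Y : (ℕ → ℝ) → ℝ} (hY : MemLp Y 2 μ)
    (hlim : Tendsto (fun n => eLpNorm (process n - Y) 2 μ) atTop (𝓝 0)) (n : ℕ) :
    process n =ᵐ[μ] μ[Y | rankFiltration n] := by
  refine hμ.martingale_process.eq_condExp_of_tendsto_eLpNorm (hY.integrable (by norm_num)) ?_ n
  refine tendsto_of_tendsto_of_tendsto_of_le_of_le tendsto_const_nhds hlim (fun _ => zero_le) ?_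
  intro n
  exact eLpNorm_le_eLpNorm_of_exponent_le (by norm_num) ((memLp_process μ n).sub hY).1

lemma integral_limit (hμ : IsExchangeable μ) {Y : (ℕ → ℝ) → ℝ} (hY : MemLp Y 2 μ)
    (hlim : Tendsto (fun n => eLpNorm (process n - Y) 2 μ) atTop (𝓝 0)) : ∫ x, Y x ∂μ = 0 := by
  rw [← integral_condExp (rankFiltration.le 0),
    ← integral_congr_ae (hμ.process_eq_condExp hY hlim 0), hμ.integral_process]

/-- Conditional Jensen for `y ↦ exp (t * y)`, with the process at time `n` as the conditional
expectation of `Y`. -/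
lemma mgf_process_le (hμ : IsExchangeable μ) {Y : (ℕ → ℝ) → ℝ} (hY : MemLp Y 2 μ)
    (hlim : Tendsto (fun n => eLpNorm (process n - Y) 2 μ) atTop (𝓝 0)) (n : ℕ) {t : ℝ}
    (ht : Integrable (fun x => Real.exp (t * Y x)) μ) :
    mgf (process n) μ t ≤ mgf Y μ t := by
  have hc : ConvexOn ℝ Set.univ fun y : ℝ => Real.exp (t * y) :=
    convexOn_exp.comp_linearMap (LinearMap.lsmul ℝ ℝ t)
  have h := hc.map_condExp_le_univ (rankFiltration.le n)
    (by fun_prop : Continuous fun y : ℝ => Real.exp (t * y)).lowerSemicontinuous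
    (hY.integrable (by norm_num)) ht
  rw [mgf, mgf, ← integral_condExp (rankFiltration.le n) (f := fun x => Real.exp (t * Y x))]
  refine integral_mono_ae (integrable_comp_rankHistory n fun h => Real.exp (t * centered n h))
    integrable_condExp ?_
  filter_upwards [h, hμ.process_eq_condExp hY hlim n] with x hx hx2
  simp only [hx2]
  exact hx

end IsExchangeable

/-! ### Root decomposition and the recursion for characteristic functions -/

/-- The mean of `f` over the random binary search tree with `n` nodes. -/
noncomputable def treeMean : ℕ → (BinaryTree Unit → ℂ) → ℂ
  | 0, f => f .nil
  | n + 1, f => ((n : ℂ) + 1)⁻¹ * treeMean n (sumExt f)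

lemma sumExt_fun_add (f g : BinaryTree Unit → ℂ) :
    sumExt (fun t => f t + g t) = fun t => sumExt f t + sumExt g t := by
  funext t; simp [sumExt, List.sum_map_add]

lemma sumExt_fun_const_mul (c : ℂ) (f : BinaryTree Unit → ℂ) :
    sumExt (fun t => c * f t) = fun t => c * sumExt f t := by
  funext t; simp [sumExt, List.sum_map_mul_left]

lemma treeMean_add (n : ℕ) (f g : BinaryTree Unit → ℂ) :
    treeMean n (fun t => f t + g t) = treeMean n f + treeMean n g := by
  induction n generalizing f g with
  | zero => rfl
  | succ n ih => simp only [treeMean, sumExt_fun_add, ih]; ring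

lemma treeMean_const_mul (n : ℕ) (c : ℂ) (f : BinaryTree Unit → ℂ) :
    treeMean n (fun t => c * f t) = c * treeMean n f := by
  induction n generalizing f with
  | zero => rfl
  | succ n ih => simp only [treeMean, sumExt_fun_const_mul, ih]; ring

lemma treeMean_mul_const (n : ℕ) (c : ℂ) (f : BinaryTree Unit → ℂ) :
    treeMean n (fun t => f t * c) = treeMean n f * c := by
  simp only [mul_comm _ c, treeMean_const_mul]

lemma treeMean_list_sum (n : ℕ) (L : List (BinaryTree Unit))
    (F : BinaryTree Unit → BinaryTree Unit → ℂ) :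
    treeMean n (fun r => (L.map fun l => F l r).sum) = (L.map fun l => treeMean n (F l)).sum := by
  induction L with
  | nil => simpa using treeMean_const_mul n 0 fun _ => 0
  | cons l L ih => simp only [List.map_cons, List.sum_cons, treeMean_add, ih]

/-- The subtrees at the root: given their sizes, which are uniformly distributed, they are
independent random binary search trees. -/
lemma treeMean_succ_eq_sum_antidiagonal (n : ℕ) (f : BinaryTree Unit → ℂ) :
    treeMean (n + 1) f = ((n : ℂ) + 1)⁻¹ * ∑ p ∈ Finset.HasAntidiagonal.antidiagonal n,
      treeMean p.1 fun l => treeMean p.2 fun r => f (.node () l r) := by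
  induction n generalizing f with
  | zero => simp [treeMean, sumExt_nil]
  | succ n ih =>
    have hn : ((n : ℂ) + 1) ≠ 0 := Nat.cast_add_one_ne_zero n
    let Q : ℕ × ℕ → ℂ := fun p => treeMean p.1 fun l => treeMean p.2 fun r => f (.node () l r)
    -- This is a Pólya urn: from subtree sizes `(a, b)` the new node goes left with weight `a + 1`
    -- and right with weight `b + 1`. After reindexing, each pair of sum `n + 1` collects the same
    -- weight `p.1 + p.2 = n + 1`.
    have key : ∀ p : ℕ × ℕ, (treeMean p.1 fun l => treeMean p.2 fun r =>
        sumExt f (.node () l r)) =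
        ((p.1 : ℂ) + 1) * Q (p.1 + 1, p.2) + ((p.2 : ℂ) + 1) * Q (p.1, p.2 + 1) := by
      rintro ⟨a, b⟩
      have ha : ((a : ℂ) + 1) ≠ 0 := Nat.cast_add_one_ne_zero a
      have hb : ((b : ℂ) + 1) ≠ 0 := Nat.cast_add_one_ne_zero b
      simp only [sumExt_node, treeMean_add, Q, treeMean, treeMean_const_mul]
      rw [mul_inv_cancel_left₀ ha, mul_inv_cancel_left₀ hb]
      congr 1
      congr 1
      funext l
      exact treeMean_list_sum b _ fun l' r => f (.node () l' r)
    rw [treeMean, ih, Finset.sum_congr rfl fun p _ => key p, Finset.sum_add_distrib]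
    have e1 : ∑ p ∈ Finset.HasAntidiagonal.antidiagonal n, ((p.1 : ℂ) + 1) * Q (p.1 + 1, p.2) =
        ∑ p ∈ Finset.HasAntidiagonal.antidiagonal (n + 1), (p.1 : ℂ) * Q p := by
      rw [Finset.Nat.sum_antidiagonal_succ]; simp
    have e2 : ∑ p ∈ Finset.HasAntidiagonal.antidiagonal n, ((p.2 : ℂ) + 1) * Q (p.1, p.2 + 1) =
        ∑ p ∈ Finset.HasAntidiagonal.antidiagonal (n + 1), (p.2 : ℂ) * Q p := by
      rw [Finset.Nat.sum_antidiagonal_succ']; simp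
    have e3 : ∑ p ∈ Finset.HasAntidiagonal.antidiagonal (n + 1), (p.1 : ℂ) * Q p +
        ∑ p ∈ Finset.HasAntidiagonal.antidiagonal (n + 1), (p.2 : ℂ) * Q p =
        ((n : ℂ) + 1) * ∑ p ∈ Finset.HasAntidiagonal.antidiagonal (n + 1), Q p := by
      rw [← Finset.sum_add_distrib, Finset.mul_sum]
      refine Finset.sum_congr rfl fun p hp => ?_
      rw [← add_mul, ← Nat.cast_add, Finset.HasAntidiagonal.mem_antidiagonal.1 hp]
      push_cast; rfl
    rw [e1, e2, e3, inv_mul_cancel_left₀ hn]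

lemma IsExchangeable.integral_treeOf {μ : Measure (ℕ → ℝ)} [IsProbabilityMeasure μ]
    (hμ : IsExchangeable μ) (n : ℕ) (f : BinaryTree Unit → ℂ) :
    ∫ x, f (treeOf (rankHistory x n)) ∂μ = treeMean n f := by
  induction n generalizing f with
  | zero => simp [rankHistory, treeOf, treeMean]
  | succ n ih =>
    rw [hμ.integral_rankHistory_succ n fun h => f (treeOf h), treeMean, ← ih]
    simp only [sum_treeOf_cons f (rankHistory_mem _ n)]
    rw [Complex.real_smul]
    push_cast
    rfl

/-- The characteristic function of `η_n - H_n`. -/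
noncomputable def processChar (n : ℕ) (t : ℝ) : ℂ :=
  treeMean n fun s => Complex.exp (t * ((nodeWeight s - harmonic n : ℝ) : ℂ) * Complex.I)

lemma IsExchangeable.integral_exp_process {μ : Measure (ℕ → ℝ)} [IsProbabilityMeasure μ]
    (hμ : IsExchangeable μ) (n : ℕ) (t : ℝ) :
    ∫ x, Complex.exp (t * (process n x : ℂ) * Complex.I) ∂μ = processChar n t :=
  hμ.integral_treeOf n fun s => Complex.exp (t * ((nodeWeight s - harmonic n : ℝ) : ℂ) * Complex.I)

/-- The toll of the recursion for `η_n - H_n`. -/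
noncomputable def toll (a b : ℕ) : ℝ :=
  1 + 1 / 2 * ((harmonic a - harmonic (a + b + 1) : ℝ) + (harmonic b - harmonic (a + b + 1) : ℝ))

/-- For subtree sizes `a + b = n`, the centred path length is `toll a b` plus half the sum of the
centred path lengths of the subtrees. -/
lemma processChar_succ (n : ℕ) (t : ℝ) :
    processChar (n + 1) t = ((n : ℂ) + 1)⁻¹ * ∑ p ∈ Finset.HasAntidiagonal.antidiagonal n,
      Complex.exp (t * (toll p.1 p.2 : ℂ) * Complex.I) *
        (processChar p.1 (t / 2) * processChar p.2 (t / 2)) := by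
  rw [processChar, treeMean_succ_eq_sum_antidiagonal]
  congr 1
  refine Finset.sum_congr rfl fun p hp => ?_
  have e : ∀ l r : BinaryTree Unit,
      Complex.exp (t * ((nodeWeight (.node () l r) - harmonic (n + 1) : ℝ) : ℂ) * Complex.I) =
      Complex.exp (t * (toll p.1 p.2 : ℂ) * Complex.I) *
        (Complex.exp ((t / 2 : ℝ) * ((nodeWeight l - harmonic p.1 : ℝ) : ℂ) * Complex.I) *
         Complex.exp ((t / 2 : ℝ) * ((nodeWeight r - harmonic p.2 : ℝ) : ℂ) * Complex.I)) := by
    intro l r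
    rw [← Complex.exp_add, ← Complex.exp_add, toll, Finset.HasAntidiagonal.mem_antidiagonal.1 hp, nodeWeight]
    congr 1
    push_cast
    ring
  simp only [e, treeMean_const_mul, treeMean_mul_const]
  rfl

/-! ### Passage to the limit in the recursion -/

lemma integral_comp_floor (g : ℕ → ℂ) (N : ℕ) (hN : N ≠ 0) :
    ∫ u in (0 : ℝ)..1, g ⌊(N : ℝ) * u⌋₊ = (N : ℂ)⁻¹ * ∑ k ∈ Finset.range N, g k := by
  have hN' : (N : ℝ) ≠ 0 := Nat.cast_ne_zero.2 hN
  have hk : ∀ k : ℕ, Set.EqOn (fun _ => g k) (fun x : ℝ => g ⌊x⌋₊)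
      (Set.uIoo (k : ℝ) ((k + 1 : ℕ) : ℝ)) := by
    intro k x hx
    rw [Set.uIoo_of_le (by push_cast; linarith)] at hx
    have : ⌊x⌋₊ = k := by
      rw [Nat.floor_eq_iff ((Nat.cast_nonneg k).trans hx.1.le)]
      exact ⟨hx.1.le, by simpa using hx.2⟩
    simp [this]
  rw [intervalIntegral.integral_comp_mul_left (fun x => g ⌊x⌋₊) hN', mul_zero, mul_one,
    ← Nat.cast_zero, ← intervalIntegral.sum_integral_adjacent_intervals (a := fun k : ℕ => (k : ℝ))
      fun k _ => (intervalIntegrable_const (c := g k)).congr_uIoo (hk k), Complex.real_smul]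
  push_cast
  congr 1
  refine Finset.sum_congr rfl fun k _ => ?_
  rw [← Nat.cast_succ, ← intervalIntegral.integral_congr_uIoo (hk k)]
  simp

/-- Euler's constant cancels in the difference, which leaves the logarithm of the ratio. -/
lemma tendsto_harmonic_sub_harmonic {k : ℕ → ℕ} {u : ℝ} (hu : 0 < u)
    (hk : Tendsto (fun n => (k n : ℝ) / ((n : ℝ) + 1)) atTop (𝓝 u)) :
    Tendsto k atTop atTop ∧
    Tendsto (fun n => (harmonic (k n) - harmonic (n + 1) : ℝ)) atTop (𝓝 (Real.log u)) := by
  have hn : Tendsto (fun n : ℕ => (n : ℝ) + 1) atTop atTop :=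
    tendsto_atTop_add_const_right _ _ tendsto_natCast_atTop_atTop
  have hkt : Tendsto k atTop atTop := by
    rw [← tendsto_natCast_atTop_iff (R := ℝ)]
    refine (hk.pos_mul_atTop hu hn).congr fun n => ?_
    have : ((n : ℝ) + 1) ≠ 0 := by positivity
    field_simp
  refine ⟨hkt, ?_⟩
  have h1 := Real.tendsto_harmonic_sub_log.comp hkt
  have h2 := Real.tendsto_harmonic_sub_log.comp (tendsto_add_atTop_nat 1)
  have h3 := (h1.sub h2).add (hk.log hu.ne')
  rw [sub_self, zero_add] at h3
  refine h3.congr' ?_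
  filter_upwards [hkt.eventually_gt_atTop 0] with n hkn
  have hk0 : (0 : ℝ) < k n := Nat.cast_pos.2 hkn
  have hn0 : (0 : ℝ) < (n : ℝ) + 1 := by positivity
  simp only [Function.comp]
  rw [Real.log_div hk0.ne' hn0.ne']
  push_cast
  ring

lemma tendsto_floor_div {u : ℝ} (hu : 0 < u) :
    Tendsto (fun n : ℕ => (⌊((n + 1 : ℕ) : ℝ) * u⌋₊ : ℝ) / ((n : ℝ) + 1)) atTop (𝓝 u) := by
  have h := (tendsto_nat_floor_mul_div_atTop (R := ℝ) hu.le).comp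
    (tendsto_natCast_atTop_atTop.comp (tendsto_add_atTop_nat 1))
  refine h.congr fun n => ?_
  simp [Function.comp, mul_comm]

lemma floor_le {u : ℝ} (hu0 : 0 < u) (hu : u < 1) (n : ℕ) : ⌊((n + 1 : ℕ) : ℝ) * u⌋₊ ≤ n := by
  have : ⌊((n + 1 : ℕ) : ℝ) * u⌋₊ < n + 1 := by
    rw [Nat.floor_lt (by positivity)]
    have : (0 : ℝ) < ((n + 1 : ℕ) : ℝ) := by positivity
    nlinarith
  omega

lemma tendsto_sub_floor_div {u : ℝ} (hu0 : 0 < u) (hu : u < 1) :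
    Tendsto (fun n : ℕ => ((n - ⌊((n + 1 : ℕ) : ℝ) * u⌋₊ : ℕ) : ℝ) / ((n : ℝ) + 1)) atTop
      (𝓝 (1 - u)) := by
  have h := (tendsto_natCast_div_add_atTop (1 : ℝ)).sub (tendsto_floor_div hu0)
  refine h.congr fun n => ?_
  rw [Nat.cast_sub (floor_le hu0 hu n)]
  ring

lemma norm_exp_mul_I (a b : ℝ) : ‖Complex.exp ((a : ℂ) * (b : ℂ) * Complex.I)‖ = 1 := by
  rw [← Complex.ofReal_mul, Complex.norm_exp_ofReal_mul_I]

lemma norm_processChar_le {μ : Measure (ℕ → ℝ)} [IsProbabilityMeasure μ]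
    (hμ : IsExchangeable μ) (n : ℕ) (t : ℝ) : ‖processChar n t‖ ≤ 1 := by
  rw [← hμ.integral_exp_process]
  refine (norm_integral_le_integral_norm _).trans ?_
  simp [norm_exp_mul_I]

lemma tendsto_processChar {μ : Measure (ℕ → ℝ)} [IsProbabilityMeasure μ]
    (hμ : IsExchangeable μ) {Y : (ℕ → ℝ) → ℝ} (hY : AEMeasurable Y μ)
    (hlim : ∀ᵐ x ∂μ, Tendsto (fun n => process n x) atTop (𝓝 (Y x))) (t : ℝ) :
    Tendsto (fun n => processChar n t) atTop (𝓝 (charFun (μ.map Y) t)) := by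
  rw [charFun_apply_real, integral_map hY (by fun_prop)]
  simp only [← hμ.integral_exp_process]
  refine tendsto_integral_of_dominated_convergence (fun _ => 1) (fun n => ?_) (integrable_const _)
    (fun n => ae_of_all _ fun x => (norm_exp_mul_I _ _).le) ?_
  · exact (integrable_comp_rankHistory n
      fun h => Complex.exp (t * (centered n h : ℂ) * Complex.I)).1
  · filter_upwards [hlim] with x hx
    exact ((by fun_prop : Continuous fun y : ℝ =>
      Complex.exp (t * (y : ℂ) * Complex.I)).tendsto (Y x)).comp hx

/-- `ζ` as a function of the uniform variable. -/
noncomputable def zetaFun (u : ℝ) : ℝ := 1 + (1 / 2) * (Real.log u + Real.log (1 - u))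

lemma measurable_zetaFun : Measurable zetaFun := by unfold zetaFun; fun_prop

lemma zetaLaw_eq : zetaLaw = unif.map zetaFun := rfl

instance : IsProbabilityMeasure zetaLaw := by
  rw [zetaLaw_eq]; exact Measure.isProbabilityMeasure_map measurable_zetaFun.aemeasurable

lemma integral_unif {E : Type*} [NormedAddCommGroup E] [NormedSpace ℝ E] (f : ℝ → E) :
    ∫ u, f u ∂unif = ∫ u in (0 : ℝ)..1, f u := by
  rw [unif, integral_Icc_eq_integral_Ioc, intervalIntegral.integral_of_le zero_le_one]

/-- The size of the left subtree is realised as `⌊(n + 1) * u⌋₊` with `u` uniform, so the average in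
the recursion is an integral over one fixed space and dominated convergence applies. -/
lemma charFun_limit {μ : Measure (ℕ → ℝ)} [IsProbabilityMeasure μ]
    (hμ : IsExchangeable μ) {Y : (ℕ → ℝ) → ℝ} (hY : AEMeasurable Y μ)
    (hlim : ∀ᵐ x ∂μ, Tendsto (fun n => process n x) atTop (𝓝 (Y x))) (t : ℝ) :
    charFun (μ.map Y) t = charFun zetaLaw t * charFun (μ.map Y) (t / 2) ^ 2 := by
  have h1 := (tendsto_processChar hμ hY hlim t).comp (tendsto_add_atTop_nat 1)
  refine tendsto_nhds_unique h1 ?_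
  let g : ℕ → ℕ → ℂ := fun n k => Complex.exp (t * (toll k (n - k) : ℂ) * Complex.I) *
        (processChar k (t / 2) * processChar (n - k) (t / 2))
  have e : ∀ n, processChar (n + 1) t = ∫ u in (0 : ℝ)..1, g n ⌊((n + 1 : ℕ) : ℝ) * u⌋₊ := by
    intro n
    rw [integral_comp_floor _ _ n.succ_ne_zero, processChar_succ,
      Finset.Nat.sum_antidiagonal_eq_sum_range_succ_mk]
    push_cast
    rfl
  have e2 : charFun zetaLaw t * charFun (μ.map Y) (t / 2) ^ 2 =
      ∫ u in (0 : ℝ)..1, Complex.exp (t * (zetaFun u : ℂ) * Complex.I) *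
        (charFun (μ.map Y) (t / 2) * charFun (μ.map Y) (t / 2)) := by
    rw [intervalIntegral.integral_mul_const, ← integral_unif, zetaLaw_eq, charFun_apply_real,
      integral_map measurable_zetaFun.aemeasurable (by fun_prop), sq]
  rw [e2]
  simp only [Function.comp_def, e]
  refine intervalIntegral.tendsto_integral_filter_of_dominated_convergence (fun _ => 1)
    (Eventually.of_forall fun n => ?_) (Eventually.of_forall fun n => ae_of_all _ fun u _ => ?_)
    intervalIntegrable_const ?_
  · have : Measurable fun u : ℝ => ⌊((n + 1 : ℕ) : ℝ) * u⌋₊ :=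
      Nat.measurable_floor.comp (measurable_id.const_mul _)
    exact ((measurable_from_top (f := g n)).comp this).aestronglyMeasurable
  · simp only [g, norm_mul, norm_exp_mul_I, one_mul]
    exact mul_le_one₀ (norm_processChar_le hμ _ _) (norm_nonneg _) (norm_processChar_le hμ _ _)
  · have h01 : ∀ᵐ u : ℝ, u ≠ 1 := by simp [ae_iff]
    filter_upwards [h01] with u hu1 hu
    rw [Set.uIoc_of_le zero_le_one] at hu
    have hu2 : u < 1 := lt_of_le_of_ne hu.2 hu1
    obtain ⟨ha, ha'⟩ := tendsto_harmonic_sub_harmonic hu.1 (tendsto_floor_div hu.1)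
    obtain ⟨hb, hb'⟩ := tendsto_harmonic_sub_harmonic (sub_pos.2 hu2)
      (tendsto_sub_floor_div hu.1 hu2)
    have ht : Tendsto (fun n : ℕ => toll ⌊((n + 1 : ℕ) : ℝ) * u⌋₊ (n - ⌊((n + 1 : ℕ) : ℝ) * u⌋₊))
        atTop (𝓝 (zetaFun u)) := by
      refine (((ha'.add hb').const_mul (1 / 2)).const_add 1).congr fun n => ?_
      rw [toll, Nat.add_sub_cancel' (floor_le hu.1 hu2 n)]
    have hψ := tendsto_processChar hμ hY hlim (t / 2)
    exact (((by fun_prop : Continuous fun y : ℝ =>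
      Complex.exp (t * (y : ℂ) * Complex.I)).tendsto _).comp ht).mul
        ((hψ.comp ha).mul (hψ.comp hb))

/-! ### Moments of the law of ζ -/

section zetaLaw

/-- Here `exp (t * ζ) = exp t * (u * (1 - u)) ^ (t / 2)`, a Beta integrand with both parameters `1 +
t / 2 > 0`. -/
lemma integrable_exp_zetaLaw {t : ℝ} (ht : -2 < t) :
    Integrable (fun z => Real.exp (t * z)) zetaLaw := by
  rw [zetaLaw_eq, integrable_map_measure (by fun_prop) measurable_zetaFun.aemeasurable, unif,
    ← IntegrableOn, integrableOn_Icc_iff_integrableOn_Ioo]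
  have h0 : 0 < Complex.re ((1 + t / 2 : ℝ) : ℂ) := by
    rw [Complex.ofReal_re]; linarith
  have h := (Complex.betaIntegral_convergent h0 h0).norm.const_mul (Real.exp t)
  rw [intervalIntegrable_iff_integrableOn_Ioo_of_le zero_le_one] at h
  refine h.congr_fun (fun u hu => ?_) measurableSet_Ioo
  have hu0 : 0 < u := hu.1
  have hu1 : 0 < 1 - u := sub_pos.2 hu.2
  have e : ((1 + t / 2 : ℝ) : ℂ) - 1 = ((t / 2 : ℝ) : ℂ) := by push_cast; ring
  simp only [Function.comp]
  rw [norm_mul, e, ← Complex.ofReal_one, ← Complex.ofReal_sub,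
    Complex.norm_cpow_eq_rpow_re_of_pos hu0, Complex.norm_cpow_eq_rpow_re_of_pos hu1,
    Complex.ofReal_re, Real.rpow_def_of_pos hu0, Real.rpow_def_of_pos hu1, ← Real.exp_add,
    ← Real.exp_add, zetaFun]
  congr 1
  ring

lemma mem_interior_integrableExpSet_zetaLaw {t : ℝ} (ht : -2 < t) :
    t ∈ interior (integrableExpSet id zetaLaw) := by
  rw [mem_interior]
  exact ⟨Set.Ioi (-2), fun s hs => integrable_exp_zetaLaw hs, isOpen_Ioi, ht⟩

lemma memLp_id_zetaLaw : MemLp id 2 zetaLaw := by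
  exact_mod_cast memLp_of_mem_interior_integrableExpSet
    (mem_interior_integrableExpSet_zetaLaw (by norm_num)) 2

lemma integral_zetaLaw : ∫ z, z ∂zetaLaw = 0 := by
  rw [zetaLaw_eq, integral_map measurable_zetaFun.aemeasurable (by fun_prop), integral_unif]
  have i1 : IntervalIntegrable (fun u : ℝ => Real.log u) volume 0 1 :=
    intervalIntegral.intervalIntegrable_log'
  have i2 : IntervalIntegrable (fun u : ℝ => Real.log (1 - u)) volume 0 1 := by
    simpa using (i1.comp_sub_left 1).symm
  unfold zetaFun
  rw [intervalIntegral.integral_add intervalIntegrable_const ((i1.add i2).const_mul _),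
    intervalIntegral.integral_const_mul, intervalIntegral.integral_add i1 i2,
    intervalIntegral.integral_comp_sub_left (fun u => Real.log u)]
  norm_num [integral_log]

lemma exp_le_quadratic (w : ℝ) : Real.exp w ≤ 1 + w + w ^ 2 * (1 + Real.exp w) := by
  have hw := Real.exp_pos w
  by_cases h : |w| ≤ 1
  · have := (abs_le.1 (Real.abs_exp_sub_one_sub_id_le h)).2
    nlinarith [sq_nonneg w]
  · have h1 : 1 ≤ w ^ 2 := by
      rw [← sq_abs]; nlinarith [not_le.1 h]
    rcases le_total 0 w with h2 | h2
    · nlinarith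
    · have h3 : Real.exp w ≤ 1 := Real.exp_le_one_iff.2 h2
      rw [abs_of_nonpos h2] at h
      nlinarith

/-- A quadratic bound for the moment generating function of `ζ` along a segment. -/
lemma exists_mgf_zetaLaw_le {t : ℝ} (ht : -2 < t) : ∃ C : ℝ, 0 ≤ C ∧
    ∀ c : ℝ, 0 ≤ c → c ≤ 1 → ∫ z, Real.exp (c * t * z) ∂zetaLaw ≤ Real.exp (c ^ 2 * C) := by
  have i1 : Integrable (fun z : ℝ => z ^ 2) zetaLaw := by
    simpa using memLp_id_zetaLaw.integrable_sq
  have i2 : Integrable (fun z : ℝ => z ^ 2 * Real.exp (t * z)) zetaLaw := by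
    simpa using integrable_pow_mul_exp_of_mem_interior_integrableExpSet
      (mem_interior_integrableExpSet_zetaLaw ht) 2
  have i0 : Integrable (fun z : ℝ => z) zetaLaw := memLp_id_zetaLaw.integrable (by norm_num)
  have i3 : Integrable (fun z : ℝ => (t * z) ^ 2 * (2 + Real.exp (t * z))) zetaLaw := by
    refine ((i1.const_mul (2 * t ^ 2)).add (i2.const_mul (t ^ 2))).congr (ae_of_all _ fun z => ?_)
    simp only [Pi.add_apply]; ring
  refine ⟨∫ z, (t * z) ^ 2 * (2 + Real.exp (t * z)) ∂zetaLaw,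
    integral_nonneg fun z => by positivity, fun c hc0 hc1 => ?_⟩
  have hct : -2 < c * t := by
    rcases le_total 0 t with h | h
    · have := mul_nonneg hc0 h; linarith
    · nlinarith
  have h : ∀ z, Real.exp (c * t * z) ≤
      1 + c * t * z + c ^ 2 * ((t * z) ^ 2 * (2 + Real.exp (t * z))) := by
    intro z
    have h1 := exp_le_quadratic (c * t * z)
    -- This makes the bound uniform in `c`: the exponent lies between 0 and `t * z`.
    have h2 : Real.exp (c * t * z) ≤ 1 + Real.exp (t * z) := by
      rw [mul_assoc]
      rcases le_total 0 (t * z) with h | h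
      · have : Real.exp (c * (t * z)) ≤ Real.exp (t * z) :=
          Real.exp_le_exp.2 (mul_le_of_le_one_left h hc1)
        linarith
      · have : Real.exp (c * (t * z)) ≤ 1 :=
          Real.exp_le_one_iff.2 (mul_nonpos_of_nonneg_of_nonpos hc0 h)
        linarith [Real.exp_pos (t * z)]
    have h3 : (c * t * z) ^ 2 * (1 + Real.exp (c * t * z)) ≤
        (c * t * z) ^ 2 * (2 + Real.exp (t * z)) :=
      mul_le_mul_of_nonneg_left (by linarith) (sq_nonneg _)
    nlinarith
  have i4 : Integrable (fun z : ℝ => 1 + c * t * z) zetaLaw :=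
    (integrable_const 1).add (i0.const_mul (c * t))
  calc ∫ z, Real.exp (c * t * z) ∂zetaLaw
      ≤ ∫ z, (1 + c * t * z + c ^ 2 * ((t * z) ^ 2 * (2 + Real.exp (t * z)))) ∂zetaLaw :=
        integral_mono (integrable_exp_zetaLaw hct) (i4.add (i3.const_mul _)) h
    _ = c ^ 2 * (∫ z, (t * z) ^ 2 * (2 + Real.exp (t * z)) ∂zetaLaw) + 1 := by
        rw [integral_add i4 (i3.const_mul _), integral_add (integrable_const 1) (i0.const_mul _),
          integral_const_mul, integral_const_mul, integral_zetaLaw]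
        simp; ring
    _ ≤ _ := Real.add_one_le_exp _

end zetaLaw

/-! ### Convergence and exponential moments of the series -/

/-- A sequence whose increments decay geometrically in quadratic mean converges almost surely and in
quadratic mean. -/
lemma exists_limit_of_geometric {Ω : Type*} [MeasurableSpace Ω] {Q : Measure Ω}
    {S : ℕ → Ω → ℝ} (hS : ∀ n, MemLp (S n) 2 Q) {C q : ℝ} (hC : 0 < C) (hq0 : 0 < q) (hq1 : q < 1)
    (h : ∀ n, eLpNorm (S (n + 1) - S n) 2 Q ≤ ENNReal.ofReal (C * q ^ n)) :
    ∃ Z : Ω → ℝ, MemLp Z 2 Q ∧ (∀ᵐ ω ∂Q, Tendsto (fun n => S n ω) atTop (𝓝 (Z ω))) ∧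
      Tendsto (fun n => eLpNorm (S n - Z) 2 Q) atTop (𝓝 0) := by
  have hq : 0 < 1 - q := sub_pos.2 hq1
  have h1 : ∀ N k, eLpNorm (S (N + k) - S N) 2 Q ≤
      ENNReal.ofReal (C * q ^ N * (1 - q ^ k) / (1 - q)) := by
    intro N k
    induction k with
    | zero => simp
    | succ k ih =>
      have e : S (N + (k + 1)) - S N = (S (N + k) - S N) + (S (N + k + 1) - S (N + k)) := by
        rw [← add_assoc]; abel
      rw [e]
      refine (eLpNorm_add_le ((hS _).sub (hS _)).1 ((hS _).sub (hS _)).1 (by norm_num)).trans ?_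
      refine (add_le_add ih (h (N + k))).trans ?_
      have hqk : q ^ k ≤ 1 := pow_le_one₀ hq0.le hq1.le
      rw [← ENNReal.ofReal_add (by have := sub_nonneg.2 hqk; positivity) (by positivity)]
      refine ENNReal.ofReal_le_ofReal (le_of_eq ?_)
      field_simp
      ring
  have h2 : ∀ N k, eLpNorm (S (N + k) - S N) 2 Q ≤ ENNReal.ofReal (C * q ^ N / (1 - q)) := by
    intro N k
    refine (h1 N k).trans (ENNReal.ofReal_le_ofReal ?_)
    have hqk : 0 ≤ q ^ k := by positivity
    have hc : 0 ≤ C * q ^ N := by positivity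
    exact div_le_div_of_nonneg_right (mul_le_of_le_one_right hc (by linarith)) hq.le
  -- The triangle inequality gives the factor 2; the factor 3 makes the Cauchy bound strict.
  let B : ℕ → ENNReal := fun N => ENNReal.ofReal (3 * C / (1 - q) * q ^ N)
  have hB : ∑' i, B i ≠ ⊤ := by
    have hs : Summable fun N => 3 * C / (1 - q) * q ^ N :=
      (summable_geometric_of_lt_one hq0.le hq1).mul_left _
    exact hs.tsum_ofReal_ne_top
  have hcau : ∀ N n m : ℕ, N ≤ n → N ≤ m → eLpNorm (S n - S m) 2 Q < B N := by
    intro N n m hn hm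
    obtain ⟨a, rfl⟩ := Nat.exists_eq_add_of_le hn
    obtain ⟨b, rfl⟩ := Nat.exists_eq_add_of_le hm
    have e : S (N + a) - S (N + b) = (S (N + a) - S N) - (S (N + b) - S N) := by abel
    rw [e]
    refine (eLpNorm_sub_le ((hS _).sub (hS _)).1 ((hS _).sub (hS _)).1 (by norm_num)).trans_lt ?_
    refine (add_le_add (h2 N a) (h2 N b)).trans_lt ?_
    have hp : 0 < C * q ^ N / (1 - q) := by positivity
    rw [← ENNReal.ofReal_add hp.le hp.le]
    have e2 : 3 * C / (1 - q) * q ^ N = 3 * (C * q ^ N / (1 - q)) := by ring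
    simp only [B, e2]
    exact (ENNReal.ofReal_lt_ofReal_iff (by positivity)).2 (by linarith)
  obtain ⟨Z, hZm, hZ⟩ := measurable_limit_of_tendsto_metrizable_ae
    (fun n => (hS n).1.aemeasurable)
    (Lp.ae_tendsto_of_cauchy_eLpNorm (fun n => (hS n).1) (by norm_num) hB hcau)
  have hL := Lp.cauchy_tendsto_of_tendsto (fun n => (hS n).1) Z hB hcau hZ
  exact ⟨Z, Lp.memLp_of_cauchy_tendsto (by norm_num) hS Z hZm.aestronglyMeasurable hL, hZ, hL⟩

/-- The index set of the first `N` levels of the complete binary tree. -/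
def levels (N : ℕ) : Finset (Σ n : ℕ, Fin (2 ^ n)) := (Finset.range N).sigma fun _ => Finset.univ

lemma zetaSum_eq (z : (Σ n : ℕ, Fin (2 ^ n)) → ℝ) (N : ℕ) :
    zetaSum z N = ∑ i ∈ levels N, ((2 : ℝ) ^ i.1)⁻¹ * z i := by
  rw [zetaSum, levels, Finset.sum_sigma]
  simp only [Finset.mul_sum]

lemma zetaSum_succ_sub (z : (Σ n : ℕ, Fin (2 ^ n)) → ℝ) (N : ℕ) :
    zetaSum z (N + 1) - zetaSum z N = ((2 : ℝ) ^ N)⁻¹ * ∑ k : Fin (2 ^ N), z ⟨N, k⟩ := by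
  rw [zetaSum, zetaSum, Finset.sum_range_succ, add_sub_cancel_left]

/-- A family of independent random variables, indexed by the nodes of the complete binary tree, with
the distribution of `ζ_∞`. -/
structure IsZetaFamily {Ω : Type*} [MeasurableSpace Ω] (Q : Measure Ω)
    (ζ : (Σ n : ℕ, Fin (2 ^ n)) → Ω → ℝ) : Prop where
  meas : ∀ i, Measurable (ζ i)
  indep : iIndepFun ζ Q
  law : ∀ i, Q.map (ζ i) = zetaLaw

namespace IsZetaFamily

variable {Ω : Type*} [MeasurableSpace Ω] {Q : Measure Ω} {ζ : (Σ n : ℕ, Fin (2 ^ n)) → Ω → ℝ}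

lemma memLp (h : IsZetaFamily Q ζ) (i : Σ n : ℕ, Fin (2 ^ n)) : MemLp (ζ i) 2 Q := by
  have h2 := memLp_id_zetaLaw
  rw [← h.law i] at h2
  exact (memLp_map_measure_iff aestronglyMeasurable_id (h.meas i).aemeasurable).1 h2

lemma integral_eq_zero (h : IsZetaFamily Q ζ) (i : Σ n : ℕ, Fin (2 ^ n)) : ∫ ω, ζ i ω ∂Q = 0 := by
  rw [← integral_zetaLaw, ← h.law i, integral_map (h.meas i).aemeasurable (by fun_prop)]

lemma variance_eq (h : IsZetaFamily Q ζ) (i : Σ n : ℕ, Fin (2 ^ n)) :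
    variance (ζ i) Q = variance id zetaLaw := by
  rw [← h.law i, variance_id_map (h.meas i).aemeasurable]

lemma memLp_zetaSum (h : IsZetaFamily Q ζ) (N : ℕ) :
    MemLp (fun ω => zetaSum (fun i => ζ i ω) N) 2 Q := by
  simp only [zetaSum_eq]
  exact memLp_finsetSum _ fun i _ => (h.memLp i).const_mul _

lemma weighted_indep (h : IsZetaFamily Q ζ) :
    iIndepFun (fun i : (Σ n : ℕ, Fin (2 ^ n)) => fun ω => ((2 : ℝ) ^ i.1)⁻¹ * ζ i ω) Q :=
  h.indep.comp (fun i z => ((2 : ℝ) ^ i.1)⁻¹ * z) fun _ => measurable_id.const_mul _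

/-- Level `N` has `2 ^ N` independent centred terms of weight `2 ^ (-N)`, hence variance `2 ^ (-N)`
times that of `ζ`. The added 1 makes the constant positive. -/
lemma eLpNorm_level_le [IsProbabilityMeasure Q] (h : IsZetaFamily Q ζ) (N : ℕ) :
    eLpNorm ((fun ω => zetaSum (fun i => ζ i ω) (N + 1)) - fun ω => zetaSum (fun i => ζ i ω) N) 2 Q
      ≤ ENNReal.ofReal ((√(variance id zetaLaw) + 1) * √(1 / 2) ^ N) := by
  rw [eLpNorm_two_eq_ofReal_sqrt ((h.memLp_zetaSum _).sub (h.memLp_zetaSum _))]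
  refine ENNReal.ofReal_le_ofReal ?_
  have hs : MemLp (∑ k : Fin (2 ^ N), ζ ⟨N, k⟩) 2 Q := memLp_finsetSum' _ fun k _ => h.memLp _
  have hint : ∫ ω, (∑ k : Fin (2 ^ N), ζ ⟨N, k⟩) ω ∂Q = 0 := by
    simp only [Finset.sum_apply]
    rw [integral_finsetSum _ fun k _ => (h.memLp _).integrable (by norm_num)]
    simp [h.integral_eq_zero]
  have hv : ∫ ω, (∑ k : Fin (2 ^ N), ζ ⟨N, k⟩) ω ^ 2 ∂Q = 2 ^ N * variance id zetaLaw := by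
    have h1 := IndepFun.variance_sum (s := Finset.univ) (X := fun k : Fin (2 ^ N) => ζ ⟨N, k⟩)
      (fun k _ => h.memLp _) fun k _ l _ hkl => h.indep.indepFun (by simpa using hkl)
    rw [variance_of_integral_eq_zero hs.1.aemeasurable hint] at h1
    rw [h1]
    simp [h.variance_eq]
  have e : ∀ ω, ((fun ω => zetaSum (fun i => ζ i ω) (N + 1)) -
      fun ω => zetaSum (fun i => ζ i ω) N) ω ^ 2 =
      (((2 : ℝ) ^ N)⁻¹) ^ 2 * (∑ k : Fin (2 ^ N), ζ ⟨N, k⟩) ω ^ 2 := by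
    intro ω
    rw [Pi.sub_apply, zetaSum_succ_sub, mul_pow, Finset.sum_apply]
  simp only [e]
  rw [integral_const_mul, hv]
  have e2 : (((2 : ℝ) ^ N)⁻¹) ^ 2 * (2 ^ N * variance id zetaLaw) =
      variance id zetaLaw * (√(1 / 2) ^ N) ^ 2 := by
    rw [← pow_mul, mul_comm N 2, pow_mul, Real.sq_sqrt (by norm_num), one_div_pow]
    field_simp
  rw [e2, Real.sqrt_mul (variance_nonneg _ _), Real.sqrt_sq (by positivity)]
  gcongr
  linarith

lemma exists_limit [IsProbabilityMeasure Q] (h : IsZetaFamily Q ζ) : ∃ S : Ω → ℝ, MemLp S 2 Q ∧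
    (∀ᵐ ω ∂Q, Tendsto (fun N => zetaSum (fun i => ζ i ω) N) atTop (𝓝 (S ω))) ∧
    Tendsto (fun N => eLpNorm (fun ω => zetaSum (fun i => ζ i ω) N - S ω) 2 Q) atTop (𝓝 0) := by
  refine exists_limit_of_geometric h.memLp_zetaSum (by positivity) (by positivity) ?_
    h.eLpNorm_level_le
  rw [Real.sqrt_lt' one_pos]; norm_num

lemma charFun_zetaSum (h : IsZetaFamily Q ζ) (N : ℕ) (t : ℝ) :
    charFun (Q.map fun ω => zetaSum (fun i => ζ i ω) N) t =
      ∏ n ∈ Finset.range N, charFun zetaLaw (t / 2 ^ n) ^ 2 ^ n := by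
  simp only [zetaSum_eq]
  rw [iIndepFun.charFun_map_fun_finsetSum_eq_prod
    (fun i _ => ((h.meas i).const_mul _).aemeasurable) (h.weighted_indep.restrict _),
    Finset.prod_apply, levels, Finset.prod_sigma]
  refine Finset.prod_congr rfl fun n _ => ?_
  have e : ∀ k : Fin (2 ^ n), charFun (Q.map fun ω => ((2 : ℝ) ^ n)⁻¹ * ζ ⟨n, k⟩ ω) t =
      charFun zetaLaw (t / 2 ^ n) := by
    intro k
    rw [charFun_map_mul_comp (h.meas _).aemeasurable, h.law, inv_mul_eq_div]
  simp [e]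

lemma integrable_exp_zetaSum [IsProbabilityMeasure Q] (h : IsZetaFamily Q ζ) {t : ℝ} (ht : -2 < t) (N : ℕ) :
    Integrable (fun ω => Real.exp (t * zetaSum (fun i => ζ i ω) N)) Q := by
  have h1 := h.weighted_indep.integrable_exp_mul_sum (t := t) (s := levels N)
    (fun i => (h.meas i).const_mul _) fun i _ => by
      have hc : (0 : ℝ) < ((2 : ℝ) ^ i.1)⁻¹ := by positivity
      have hc1 : ((2 : ℝ) ^ i.1)⁻¹ ≤ 1 := inv_le_one_of_one_le₀ (one_le_pow₀ (by norm_num))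
      have h2 : -2 < ((2 : ℝ) ^ i.1)⁻¹ * t := by
        rcases le_total 0 t with h | h
        · have := mul_nonneg hc.le h; linarith
        · nlinarith
      have h3 := integrable_exp_zetaLaw h2
      rw [← h.law i, integrable_map_measure (by fun_prop) (h.meas i).aemeasurable] at h3
      refine h3.congr (ae_of_all _ fun ω => ?_)
      simp only [Function.comp]
      congr 1; ring
  simpa only [zetaSum_eq, Finset.sum_apply] using h1

lemma exists_mgf_zetaSum_le (h : IsZetaFamily Q ζ) {t : ℝ} (ht : -2 < t) : ∃ K : ℝ, ∀ N,
    ∫ ω, Real.exp (t * zetaSum (fun i => ζ i ω) N) ∂Q ≤ K := by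
  obtain ⟨C, hC, hb⟩ := exists_mgf_zetaLaw_le ht
  -- Level `n` contributes `2 ^ n * 4 ^ (-n) * C` to the exponent, and the geometric series sums to
  -- `2 * C`.
  refine ⟨Real.exp (2 * C), fun N => ?_⟩
  have h1 := h.weighted_indep.mgf_sum (t := t) (fun i => (h.meas i).const_mul _) (levels N)
  have e1 : mgf (∑ i ∈ levels N, fun ω => ((2 : ℝ) ^ i.1)⁻¹ * ζ i ω) Q t =
      ∫ ω, Real.exp (t * zetaSum (fun i => ζ i ω) N) ∂Q := by
    simp only [mgf, zetaSum_eq, Finset.sum_apply]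
  have e2 : ∀ i : (Σ n : ℕ, Fin (2 ^ n)), mgf (fun ω => ((2 : ℝ) ^ i.1)⁻¹ * ζ i ω) Q t ≤
      Real.exp ((((2 : ℝ) ^ i.1)⁻¹) ^ 2 * C) := by
    intro i
    refine le_of_eq_of_le ?_ (hb (((2 : ℝ) ^ i.1)⁻¹) (by positivity)
      (inv_le_one_of_one_le₀ (one_le_pow₀ (by norm_num))))
    rw [mgf, ← h.law i, integral_map (h.meas i).aemeasurable (by fun_prop)]
    refine integral_congr_ae (ae_of_all _ fun ω => ?_)
    show Real.exp _ = Real.exp _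
    congr 1; ring
  rw [← e1, h1]
  refine (Finset.prod_le_prod (fun i _ => mgf_nonneg) fun i _ => e2 i).trans ?_
  rw [← Real.exp_sum, levels, Finset.sum_sigma]
  refine Real.exp_le_exp.2 ?_
  have e3 : ∀ n : ℕ, ∑ _k : Fin (2 ^ n), (((2 : ℝ) ^ n)⁻¹) ^ 2 * C = (1 / 2) ^ n * C := by
    intro n
    simp only [Finset.sum_const, Finset.card_univ, Fintype.card_fin, nsmul_eq_mul, one_div, inv_pow]
    push_cast
    field_simp
  simp only [e3]
  rw [← Finset.sum_mul]
  refine mul_le_mul_of_nonneg_right ?_ hC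
  have := Summable.sum_le_tsum (Finset.range N) (fun n _ => by positivity)
    (summable_geometric_two)
  rwa [tsum_geometric_two] at this

lemma integrable_exp_limit [IsProbabilityMeasure Q] (h : IsZetaFamily Q ζ) {S : Ω → ℝ} (hSm : AEStronglyMeasurable S Q)
    (hS : ∀ᵐ ω ∂Q, Tendsto (fun N => zetaSum (fun i => ζ i ω) N) atTop (𝓝 (S ω))) {t : ℝ}
    (ht : -2 < t) : Integrable (fun ω => Real.exp (t * S ω)) Q := by
  obtain ⟨K, hK⟩ := h.exists_mgf_zetaSum_le ht
  rw [← memLp_one_iff_integrable]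
  refine ⟨(Real.continuous_exp.comp (continuous_const_mul t)).comp_aestronglyMeasurable hSm, ?_⟩
  have h1 : eLpNorm (fun ω => Real.exp (t * S ω)) 1 Q ≤ ENNReal.ofReal K := by
    refine (Lp.eLpNorm_lim_le_liminf_eLpNorm
      (f := fun N ω => Real.exp (t * zetaSum (fun i => ζ i ω) N))
      (fun N => (h.integrable_exp_zetaSum ht N).1) _ ?_).trans ?_
    · filter_upwards [hS] with ω hω
      exact (Real.continuous_exp.tendsto _).comp (hω.const_mul t)
    · have h2 : ∀ N, eLpNorm (fun ω => Real.exp (t * zetaSum (fun i => ζ i ω) N)) 1 Q ≤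
          ENNReal.ofReal K := by
        intro N
        rw [eLpNorm_one_eq_lintegral_enorm, ← ofReal_integral_norm_eq_lintegral_enorm
          (h.integrable_exp_zetaSum ht N)]
        refine ENNReal.ofReal_le_ofReal ?_
        simpa using hK N
      exact (Filter.liminf_le_liminf (Eventually.of_forall h2)).trans (by simp)
  exact h1.trans_lt ENNReal.ofReal_lt_top

lemma tendsto_charFun [IsProbabilityMeasure Q] (h : IsZetaFamily Q ζ) {S : Ω → ℝ} (hSm : AEMeasurable S Q)
    (hS : ∀ᵐ ω ∂Q, Tendsto (fun N => zetaSum (fun i => ζ i ω) N) atTop (𝓝 (S ω))) (t : ℝ) :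
    Tendsto (fun N => ∏ n ∈ Finset.range N, charFun zetaLaw (t / 2 ^ n) ^ 2 ^ n) atTop
      (𝓝 (charFun (Q.map S) t)) := by
  have e0 := funext fun N => (h.charFun_zetaSum N t).symm
  rw [e0]
  simp only [charFun_apply_real]
  rw [integral_map hSm (by fun_prop)]
  have e : ∀ N, ∫ x, Complex.exp (t * x * Complex.I) ∂(Q.map fun ω => zetaSum (fun i => ζ i ω) N) =
      ∫ ω, Complex.exp (t * (zetaSum (fun i => ζ i ω) N : ℂ) * Complex.I) ∂Q := fun N =>
    integral_map (h.memLp_zetaSum N).1.aemeasurable (by fun_prop)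
  simp only [e]
  have hc : Continuous fun y : ℝ => Complex.exp (t * (y : ℂ) * Complex.I) := by fun_prop
  refine tendsto_integral_of_dominated_convergence (fun _ => 1)
    (fun N => hc.comp_aestronglyMeasurable (h.memLp_zetaSum N).1) (integrable_const _)
    (fun n => ae_of_all _ fun x => (norm_exp_mul_I _ _).le) ?_
  filter_upwards [hS] with ω hω
  exact (hc.tendsto (S ω)).comp hω

end IsZetaFamily

/-! ### Uniqueness for the functional equation -/

lemma norm_exp_I_sub_le (w : ℝ) :
    ‖Complex.exp ((w : ℂ) * Complex.I) - 1 - w * Complex.I‖ ≤ 3 * w ^ 2 := by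
  have hn : ‖(w : ℂ) * Complex.I‖ = |w| := by simp
  by_cases h : |w| ≤ 1
  · refine (Complex.norm_exp_sub_one_sub_id_le (hn.trans_le h)).trans ?_
    rw [hn, sq_abs]; nlinarith [sq_nonneg w]
  · refine (norm_sub_le _ _).trans ?_
    rw [hn]
    have h1 := norm_sub_le (Complex.exp ((w : ℂ) * Complex.I)) 1
    rw [Complex.norm_exp_ofReal_mul_I, norm_one] at h1
    have := not_le.1 h
    rw [← sq_abs w]
    nlinarith

lemma norm_charFun_sub_one_le {ν : Measure ℝ} [IsProbabilityMeasure ν] (hν : MemLp id 2 ν)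
    (h0 : ∫ y, y ∂ν = 0) (s : ℝ) : ‖charFun ν s - 1‖ ≤ s ^ 2 * ∫ y, 3 * y ^ 2 ∂ν := by
  have i1 : Integrable (fun y : ℝ => y) ν := hν.integrable (by norm_num)
  have i2 : Integrable (fun y : ℝ => y ^ 2) ν := by simpa using hν.integrable_sq
  have i3 : Integrable (fun y : ℝ => Complex.exp ((s * y : ℝ) * Complex.I)) ν := by
    refine Integrable.of_bound (by fun_prop) 1 (ae_of_all _ fun y => ?_)
    rw [Complex.norm_exp_ofReal_mul_I]
  have i4 : Integrable (fun y : ℝ => ((s * y : ℝ) : ℂ) * Complex.I) ν :=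
    ((i1.const_mul s).ofReal).mul_const _
  have e : charFun ν s - 1 =
      ∫ y, (Complex.exp ((s * y : ℝ) * Complex.I) - 1 - (s * y : ℝ) * Complex.I) ∂ν := by
    have i5 : Integrable (fun y : ℝ => Complex.exp ((s * y : ℝ) * Complex.I) - 1) ν :=
      i3.sub (integrable_const 1)
    rw [integral_sub i5 i4, integral_sub i3 (integrable_const 1),
      integral_mul_const, integral_complex_ofReal, integral_const_mul, h0, charFun_apply_real]
    simp
  rw [e, ← integral_const_mul]
  refine norm_integral_le_of_norm_le ((i2.const_mul 3).const_mul _) (ae_of_all _ fun y => ?_)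
  refine (norm_exp_I_sub_le (s * y)).trans (le_of_eq ?_)
  ring

/-- With mean 0 and finite variance, `charFun ν (t / m) = 1 + O(m ^ (-2))`, so even the `m`-th power
tends to 1; it is used along `m = 2 ^ N`. -/
lemma tendsto_charFun_pow {ν : Measure ℝ} [IsProbabilityMeasure ν] (hν : MemLp id 2 ν)
    (h0 : ∫ y, y ∂ν = 0) (t : ℝ) :
    Tendsto (fun N : ℕ => charFun ν (t / 2 ^ N) ^ 2 ^ N) atTop (𝓝 1) := by
  have h1 : Tendsto (fun m : ℕ => (m : ℂ) * (charFun ν (t / m) - 1)) atTop (𝓝 0) := by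
    have h2 : Tendsto (fun m : ℕ => (t ^ 2 * ∫ y, 3 * y ^ 2 ∂ν) / (m : ℝ)) atTop (𝓝 0) :=
      tendsto_const_div_atTop_nhds_zero_nat _
    refine squeeze_zero_norm' ?_ h2
    filter_upwards [eventually_gt_atTop 0] with m hm
    have hm' : (0 : ℝ) < m := Nat.cast_pos.2 hm
    rw [norm_mul, Complex.norm_natCast]
    refine (mul_le_mul_of_nonneg_left (norm_charFun_sub_one_le hν h0 _) hm'.le).trans (le_of_eq ?_)
    field_simp
  have h3 := Complex.tendsto_one_add_pow_exp_of_tendsto h1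
  rw [Complex.exp_zero] at h3
  have h4 := h3.comp (tendsto_pow_atTop_atTop_of_one_lt (one_lt_two : (1 : ℕ) < 2))
  refine h4.congr fun N => ?_
  simp

/-- The functional equation determines a centred square integrable distribution. -/
lemma IsZetaFamily.map_eq {Ω : Type*} [MeasurableSpace Ω] {Q : Measure Ω} [IsProbabilityMeasure Q]
    {ζ : (Σ n : ℕ, Fin (2 ^ n)) → Ω → ℝ} (h : IsZetaFamily Q ζ) {S : Ω → ℝ} (hSm : AEMeasurable S Q)
    (hS : ∀ᵐ ω ∂Q, Tendsto (fun N => zetaSum (fun i => ζ i ω) N) atTop (𝓝 (S ω)))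
    {ν : Measure ℝ} [IsProbabilityMeasure ν] (hν : MemLp id 2 ν) (h0 : ∫ y, y ∂ν = 0)
    (hfix : ∀ t, charFun ν t = charFun zetaLaw t * charFun ν (t / 2) ^ 2) : ν = Q.map S := by
  have : IsProbabilityMeasure (Q.map S) := Measure.isProbabilityMeasure_map hSm
  refine Measure.ext_of_charFun (funext fun t => ?_)
  have hprod : ∀ N : ℕ, charFun ν t = (∏ n ∈ Finset.range N, charFun zetaLaw (t / 2 ^ n) ^ 2 ^ n) *
      charFun ν (t / 2 ^ N) ^ 2 ^ N := by
    intro N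
    induction N with
    | zero => simp
    | succ N ih =>
      rw [ih, Finset.prod_range_succ, hfix (t / 2 ^ N), mul_pow, ← pow_mul, div_div, ← pow_succ,
        ← pow_succ', mul_assoc]
  have h1 := (h.tendsto_charFun hSm hS t).mul (tendsto_charFun_pow hν h0 t)
  rw [mul_one] at h1
  exact tendsto_nhds_unique (tendsto_const_nhds.congr hprod) h1

/-- There is a family as required on the infinite product space. -/
lemma isZetaFamily_infinitePi :
    IsZetaFamily (Measure.infinitePi fun _ : (Σ n : ℕ, Fin (2 ^ n)) => zetaLaw)
      fun i x => x i where
  meas i := measurable_pi_apply i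
  indep := iIndepFun_infinitePi (X := fun _ x => x) fun _ => measurable_id
  law i := (measurePreserving_eval_infinitePi _ i).map_eq

end BST

/-! ### Transfer from sequence space to the given probability space -/

theorem theorem3 {Ω : Type*} [MeasurableSpace Ω] (P : Measure Ω) [IsProbabilityMeasure P]
    (ξ : ℕ → Ω → ℝ) (hξ_meas : ∀ i, Measurable (ξ i)) (hξ_indep : iIndepFun ξ P)
    (hξ_law : ∀ i, P.map (ξ i) = BST.unif) :
    ∃ ηinf : Ω → ℝ,
      -- `ηinf` is the almost sure and quadratic mean limit of `η_n - H_n`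
      (MemLp ηinf 2 P ∧
        (∀ᵐ ω ∂P, Tendsto (fun n : ℕ => BST.eta (fun i => ξ i ω) n - (harmonic n : ℝ))
          atTop (𝓝 (ηinf ω))) ∧
        Tendsto (fun n : ℕ =>
            eLpNorm (fun ω => BST.eta (fun i => ξ i ω) n - (harmonic n : ℝ) - ηinf ω) 2 P)
          atTop (𝓝 0)) ∧
      -- the series representation, for every family of independent copies of `ζ_∞`
      (∀ (Ω' : Type*) [MeasurableSpace Ω'] (Q : Measure Ω') [IsProbabilityMeasure Q]
          (ζ : (Σ n : ℕ, Fin (2 ^ n)) → Ω' → ℝ), (∀ i, Measurable (ζ i)) → iIndepFun ζ Q →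
          (∀ i, Q.map (ζ i) = BST.zetaLaw) →
          ∃ S : Ω' → ℝ,
            MemLp S 2 Q ∧
            (∀ᵐ ω ∂Q, Tendsto (fun N : ℕ => BST.zetaSum (fun i => ζ i ω) N) atTop (𝓝 (S ω))) ∧
            Tendsto (fun N : ℕ => eLpNorm (fun ω => BST.zetaSum (fun i => ζ i ω) N - S ω) 2 Q)
              atTop (𝓝 0) ∧
            IdentDistrib ηinf S P Q) ∧
      -- the moment generating function of `ηinf` is finite on `(-2, ∞)` ...
      (∀ t : ℝ, -2 < t → Integrable (fun ω => Real.exp (t * ηinf ω)) P) ∧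
      -- ... and it dominates the moment generating functions of all `η_n - H_n` there
      (∀ n : ℕ, ∀ t : ℝ, -2 < t →
        Integrable (fun ω => Real.exp (t * (BST.eta (fun i => ξ i ω) n - (harmonic n : ℝ)))) P ∧
        mgf (fun ω => BST.eta (fun i => ξ i ω) n - (harmonic n : ℝ)) P t ≤ mgf ηinf P t) := by
  have hmm : Measurable fun ω i => ξ i ω := measurable_pi_iff.2 hξ_meas
  have hμ := BST.isExchangeable_map hξ_meas hξ_indep hξ_law
  have hμp : IsProbabilityMeasure (P.map fun ω i => ξ i ω) :=
    Measure.isProbabilityMeasure_map hmm.aemeasurable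
  have hmp : MeasurePreserving (fun ω i => ξ i ω) P (P.map fun ω i => ξ i ω) := ⟨hmm, rfl⟩
  obtain ⟨Y, hY, hae, hL2⟩ := hμ.exists_limit
  have hYa : AEMeasurable Y (P.map fun ω i => ξ i ω) := hY.1.aemeasurable
  have hη : MemLp (fun ω => Y fun i => ξ i ω) 2 P := hY.comp_measurePreserving hmp
  have hmap : P.map (fun ω => Y fun i => ξ i ω) = (P.map fun ω i => ξ i ω).map Y :=
    (AEMeasurable.map_map_of_aemeasurable hYa hmm.aemeasurable).symm
  have hinj : ∀ᵐ ω ∂P, Function.Injective fun i => ξ i ω := ae_of_ae_map hmm.aemeasurable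
    hμ.ae_injective
  -- The identity is obtained off the null event of ties, where ranks determine the tree.
  have heq : ∀ᵐ ω ∂P, ∀ n, BST.eta (fun i => ξ i ω) n - (harmonic n : ℝ) =
      BST.process n fun i => ξ i ω := by
    filter_upwards [hinj] with ω hω n
    rw [BST.eta_eq hω]
    rfl
  have hνp : IsProbabilityMeasure ((P.map fun ω i => ξ i ω).map Y) :=
    Measure.isProbabilityMeasure_map hYa
  have hν : MemLp id 2 ((P.map fun ω i => ξ i ω).map Y) :=
    (memLp_map_measure_iff aestronglyMeasurable_id hYa).2 hY
  have hν0 : ∫ y, y ∂((P.map fun ω i => ξ i ω).map Y) = 0 := by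
    rw [integral_map hYa (by fun_prop), hμ.integral_limit hY hL2]
  have hfix := BST.charFun_limit hμ hYa hae
  have hexp : ∀ t : ℝ, -2 < t → Integrable (fun x => Real.exp (t * Y x))
      (P.map fun ω i => ξ i ω) := by
    intro t ht
    -- Exponential integrability of `Y` is a property of its law alone, so it can be read off from
    -- the series built on an auxiliary product space.
    have hz := BST.isZetaFamily_infinitePi
    obtain ⟨S, hS, hSae, -⟩ := hz.exists_limit
    have h1 := hz.map_eq hS.1.aemeasurable hSae hν hν0 hfix
    have h2 := hz.integrable_exp_limit hS.1 hSae ht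
    have h3 := (integrable_map_measure (f := S) (g := fun y => Real.exp (t * y)) (by fun_prop)
      hS.1.aemeasurable).2 h2
    rw [← h1] at h3
    exact (integrable_map_measure (by fun_prop) hYa).1 h3
  have hexp' : ∀ t : ℝ, -2 < t → Integrable (fun ω => Real.exp (t * Y fun i => ξ i ω)) P :=
    fun t ht => hmp.integrable_comp_of_integrable (hexp t ht)
  refine ⟨fun ω => Y fun i => ξ i ω, ⟨hη, ?_, ?_⟩, ?_, hexp', ?_⟩
  · filter_upwards [heq, ae_of_ae_map hmm.aemeasurable hae] with ω h1 h2
    simpa only [h1] using h2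
  · refine hL2.congr fun n => ?_
    rw [eLpNorm_map_measure ((BST.memLp_process _ n).1.sub hY.1) hmm.aemeasurable]
    refine eLpNorm_congr_ae ?_
    filter_upwards [heq] with ω h1
    simp [h1]
  · intro Ω' _ Q _ ζ hm hi hl
    have hz : BST.IsZetaFamily Q ζ := ⟨hm, hi, hl⟩
    obtain ⟨S, hS, hSae, hSL⟩ := hz.exists_limit
    refine ⟨S, hS, hSae, hSL, hη.1.aemeasurable, hS.1.aemeasurable, ?_⟩
    rw [hmap]
    exact hz.map_eq hS.1.aemeasurable hSae hν hν0 hfix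
  · intro n t ht
    have hcongr : (fun ω => Real.exp (t * BST.process n fun i => ξ i ω)) =ᵐ[P]
        fun ω => Real.exp (t * (BST.eta (fun i => ξ i ω) n - (harmonic n : ℝ))) := by
      filter_upwards [heq] with ω h1
      rw [h1]
    have hint : Integrable (fun x => Real.exp (t * BST.process n x)) (P.map fun ω i => ξ i ω) :=
      BST.integrable_comp_rankHistory n fun h => Real.exp (t * BST.centered n h)
    refine ⟨(hmp.integrable_comp_of_integrable hint).congr hcongr, ?_⟩
    have h1 := hμ.mgf_process_le hY hL2 n (hexp t ht)
    rw [mgf, mgf, integral_map hmm.aemeasurable hint.1,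
      integral_map hmm.aemeasurable (hexp t ht).1, integral_congr_ae hcongr] at h1
    exact h1
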